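/- There is an absolute constant $C>0$ with the following property. Let $d,M,K\ge 1$ be integers, $\delta>0$, $0\le\gamma\le 1$, and suppose that $K^{1-\gamma}$ is an integer. Draw $MK$ codewords in $\mathbb C^d$ from the phase ensemble, $$|\psi_{mk}\rangle=\frac1{\sqrt d}\sum_{\omega=1}^d e^{i\theta_{mk}(\omega)}|\omega\rangle\qquad(1\le m\le M,\ 1\le k\le K),$$ where the phase factors $e^{i\theta_{mk}(\omega)}$ are i.i.d. with mean zero. For a nonempty set $S\subseteq\{1,\dots,K\}$ of keys (those that, given the leaked information, are still possible) let $$\rho_S=\frac1M\sum_{m=1}^M|m\rangle\langle m|_A\otimes\frac1{|S|}\sum_{k\in S}|\psi_{mk}\rangle\langle\psi_{mk}|_E ,$$ and let $I_{\rm acc}(S)$ be the accessible information of $\rho_S$ in bits, that is, the supremum of the mutual information $H(X)+H(Y)-H(X,Y)$ of the outcomes of local measurements (finite-outcome POVMs) on $A$ and on $E$. Put $$p'=\exp\Big[-M\Big(\tfrac{\delta^3K^{1-\gamma}}4-\delta\ln M-\tfrac{2d}M\ln\tfrac5\delta\Big)\Big].$$ 1. For every fixed set $S$ of $K^{1-\gamma}$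 keys, $I_{\rm acc}(S)\le C\delta\log_2 d$ except with probability at most $p'$. 2. $I_{\rm acc}(S)\le C\delta\log_2 d$ holds simultaneously for all sets $S$ of $K^{1-\gamma}$ keys, except with probability at most $\binom{K}{K^{1-\gamma}}\,p'\le\exp(K^{1-\gamma}\ln K)\,p'$. In particular, if the keys are the strings of $\kappa=\log_2K$ bits and $\gamma\kappa$ is an integer, then, except with probability at most $\binom{K}{K^{1-\gamma}}p'$, the bound $I_{\rm acc}(S)\le C\delta\log_2 d$ holds whichever $\gamma\kappa$ bits of the key leak to Eve and whatever their values are ($S$ being the set of keys compatible with the leaked bits). 3. Suppose that $M/d=\delta\le 1$, and put $$A=\tfrac{\delta^3K^{1-\gamma}}4-\delta\ln M-\tfrac2\delta\ln\tfrac5\delta,\qquad B=\tfrac4{\delta^2}\Big(\ln M+\tfrac2{\delta^2}\ln\tfrac5\delta\Big).$$ (a) If $K^{1-\gamma}>B$ and $M>K^{1-\gamma}\ln K\cdot A^{-1}$, then $A-K^{1-\gamma}\ln K/M>0$ and the bound $I_{\rm acc}(S)\le C\delta\log_2 d$ holds simultaneously for all sets $S$ of $K^{1-\gamma}$ keys,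 except with probability at most $\exp[-M(A-K^{1-\gamma}\ln K/M)]$. If, for some $\varepsilon>0$, even $K^{1-\gamma}\ge(1+\varepsilon)B$ and $M\ge(1+\varepsilon)K^{1-\gamma}\ln K\cdot A^{-1}$, then this probability is at most $\exp[-cM]$ with $c=\frac{\varepsilon^2}{1+\varepsilon}\cdot\frac2\delta\ln\frac5\delta$. (b) If $\gamma\le\frac12$, the condition $K^{1-\gamma}>B$ is implied by $K>B^{1+\gamma+2\gamma^2}$ and implies $K>B^{1+\gamma}$. That is, for small $\gamma$ it asks for $\log_2K$ to be about $(1+\gamma)\log_2B$ bits, where $K>B$ is the corresponding condition when nothing leaks. -/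

import Mathlib

open MeasureTheory ProbabilityTheory
open scoped Matrix Kronecker ComplexOrder

/-- A measurement with `n` outcomes (a POVM) on the quantum system with Hilbert space `ℂ^ι`. -/
structure POVM (ι : Type*) [Fintype ι] [DecidableEq ι] (n : ℕ) where
  effect : Fin n → Matrix ι ι ℂ
  posSemidef : ∀ j, (effect j).PosSemidef
  sum_eq_one : ∑ j, effect j = 1

/-- Shannon entropy, in bits, of a finite family of weights: `-∑ p log₂ p`. -/
noncomputable def shannonEntropy {ι : Type*} [Fintype ι] (p : ι → ℝ) : ℝ :=
  (∑ i, Real.negMulLog (p i)) / Real.log 2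

/-- Born rule: `p(x, y) = Tr (ρ (A_x ⊗ E_y))` for local measurements `A`, `E`
on the two parts of a bipartite state `ρ`. -/
noncomputable def jointOutcome {α β : Type*} [Fintype α] [DecidableEq α] [Fintype β]
    [DecidableEq β] (ρ : Matrix (α × β) (α × β) ℂ) {n n' : ℕ} (A : POVM α n) (E : POVM β n')
    (xy : Fin n × Fin n') : ℝ :=
  (Matrix.trace (ρ * (A.effect xy.1 ⊗ₖ E.effect xy.2))).re

/-- Mutual information `H(X) + H(Y) - H(X, Y)` of a joint distribution, in bits. -/
noncomputable def mutualInformation {α β : Type*} [Fintype α] [Fintype β]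
    (p : α × β → ℝ) : ℝ :=
  shannonEntropy (fun x => ∑ y, p (x, y)) + shannonEntropy (fun y => ∑ x, p (x, y))
    - shannonEntropy p

/-- Accessible information of a bipartite state: the supremum, over all pairs of local
measurements, of the mutual information of the outcomes.  It is taken in `EReal`, so that
it is an honest least upper bound. -/
noncomputable def accessibleInformation {α β : Type*} [Fintype α] [DecidableEq α] [Fintype β]
    [DecidableEq β] (ρ : Matrix (α × β) (α × β) ℂ) : EReal :=
  ⨆ (n : ℕ) (n' : ℕ) (A : POVM α n) (E : POVM β n'),
    ((mutualInformation (jointOutcome ρ A E) : ℝ) : EReal)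

/-- The vector `d^{-1/2} ∑_ω e^{i θ(ω)} |ω⟩`. -/
noncomputable def phaseVector {d : ℕ} (θ : Fin d → ℝ) : Fin d → ℂ :=
  fun ω => (1 / Real.sqrt d : ℝ) * Complex.exp (Complex.I * θ ω)

/-- The classical-quantum state shared by Alice (message `m`, uniform) and Eve, when, to Eve,
the key is uniformly distributed on the set `S`:
`(1/M) ∑_m |m⟩⟨m| ⊗ (1/|S|) ∑_{k ∈ S} |ψ_{mk}⟩⟨ψ_{mk}|`. -/
noncomputable def lockingState {d M K : ℕ} (ψ : Fin M → Fin K → Fin d → ℂ)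
    (S : Finset (Fin K)) : Matrix (Fin M × Fin d) (Fin M × Fin d) ℂ :=
  (M : ℂ)⁻¹ • ∑ m, Matrix.single m m (1 : ℂ) ⊗ₖ
    ((S.card : ℂ)⁻¹ • ∑ k ∈ S, Matrix.vecMulVec (ψ m k) (star (ψ m k)))

/-- Eve's accessible information about the message when the key is known to lie in `S`,
for the codewords with phases `θ`. -/
noncomputable def eveInformation {d M K : ℕ} (θ : Fin M → Fin K → Fin d → ℝ)
    (S : Finset (Fin K)) : EReal :=
  accessibleInformation (lockingState (fun m k => phaseVector (θ m k)) S)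

/-- The `M K` codewords are drawn i.i.d. from the phase ensemble: all the phase factors
`e^{i θ_{mk}(ω)}` are independent, identically distributed, and of zero mean. -/
structure IsPhaseEnsemble {Ω : Type*} [MeasurableSpace Ω] (P : Measure Ω) {d M K : ℕ}
    (θ : Fin M → Fin K → Fin d → Ω → ℝ) : Prop where
  measurable : ∀ m k ω, Measurable (θ m k ω)
  indep : iIndepFun
    (fun (i : Fin M × Fin K × Fin d) (x : Ω) =>
      Complex.exp (Complex.I * θ i.1 i.2.1 i.2.2 x)) P
  identDistrib : ∀ m k ω m' k' ω', IdentDistrib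
    (fun x => Complex.exp (Complex.I * θ m k ω x))
    (fun x => Complex.exp (Complex.I * θ m' k' ω' x)) P P
  mean_zero : ∀ m k ω, ∫ x, Complex.exp (Complex.I * θ m k ω x) ∂P = 0

/-- The keys, read as strings of `κ` bits, that are compatible with the leaked bits:
the positions in `T` are known to carry the values given by `b`. -/
def survivingKeys {K κ : ℕ} (bits : Fin K ≃ (Fin κ → Bool)) (T : Finset (Fin κ))
    (b : Fin κ → Bool) : Finset (Fin K) :=
  Finset.univ.filter (fun k => ∀ i ∈ T, bits k i = b i)

/-- `δ³ L / 4 - δ ln M - 2 r ln (5/δ)`, where `r` stands for the ratio `d / M` and `L` for the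
number of surviving keys. -/
noncomputable def lockingRate (r δ : ℝ) (M L : ℕ) : ℝ :=
  δ ^ 3 * L / 4 - δ * Real.log M - 2 * r * Real.log (5 / δ)

/-- `(4/δ²) (ln M + (2/δ²) ln (5/δ))`. -/
noncomputable def keyThreshold (δ : ℝ) (M : ℕ) : ℝ :=
  4 / δ ^ 2 * (Real.log M + 2 / δ ^ 2 * Real.log (5 / δ))

/-! Eve's outcome `y` has likelihood ratio `t m y` under message `m`, relative to its probability `r
y = tr E_y / d` in the maximally mixed state. By Gibbs' inequality (the reference `r` need not be
her true marginal) and the convexity of `t log t`, the mutual information is at most the mean of `t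
log t` (`mutualInformation_mul_log_two_le`). Each codeword entry has modulus `d^(-1/2)`, so `t ≤ d`;
hence a gain of at most `log d` in general. Moreover the mean of `t` is `1`, so values above `1` are
paid for by values below `1`: if for each `y` at most a fraction `δ` of the messages has `t < 1 -
η`, the mean of `t log t` is at most `2 (η + δ) log d`.

Thus only a lower bound is needed: for any `⌈δM⌉` messages, the Gram operator of their codewords
with keys in `S` must be at least `1 - η` times its mean. Otherwise too many bad messages for one
effect `E_y` would contradict this bound on the rows of a square root of `E_y`
(`exists_likelihoodRatio`).

The frame bound is random matrix concentration. For a unit vector `c`, the form `∑ c̄_i u_i` in the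
phases is sub-Gaussian with second moment `1`, so its squared modulus is sub-exponential and
Bernstein's inequality applies to the sum over codewords. A `1/2`-net of the sphere (`25^d` points)
passes from single vectors to operators, and a union bound over message sets costs `M.choose ⌈δM⌉`.
With `η` a large multiple of `δ`, both costs are absorbed by the exponent whenever `p' < 1`; if `p'
≥ 1` or `δ` is not small, the claim is trivial. Leakage is one more union bound, over key sets. -/

/-! ### Nets and quadratic forms. -/

/-- The unit sphere of a finite-dimensional real normed space of dimension `D` has a `1/2`-net
of at most `5 ^ D` points. -/
theorem exists_half_net_sphere (E : Type*) [NormedAddCommGroup E] [NormedSpace ℝ E]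
    [FiniteDimensional ℝ E] :
    ∃ N : Finset E, (∀ c ∈ N, ‖c‖ = 1) ∧ (∀ x : E, ‖x‖ = 1 → ∃ c ∈ N, ‖x - c‖ ≤ 1 / 2) ∧
      N.card ≤ 5 ^ Module.finrank ℝ E := by
  classical
  -- A separated set of maximal cardinality is a net: a far point could be added. The maximum exists
  -- because separated sets have bounded size.
  let p : Finset E → Prop := fun s =>
    (∀ c ∈ s, ‖c‖ = 1) ∧ ∀ c ∈ s, ∀ c' ∈ s, c ≠ c' → 1 / 2 ≤ ‖c - c'‖
  have hp : ∀ s, p s → s.card ≤ 5 ^ Module.finrank ℝ E := by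
    rintro s ⟨h1, h2⟩
    -- Doubling gives `1`-separated points in the ball of radius `2`, the normalization of
    -- Besicovitch's bound.
    have hinj : Function.Injective (fun x : E => (2 : ℝ) • x) :=
      smul_right_injective E two_ne_zero
    rw [← Finset.card_image_of_injective s hinj]
    apply Besicovitch.card_le_of_separated
    · intro c hc
      obtain ⟨x, hx, rfl⟩ := Finset.mem_image.1 hc
      simp [norm_smul, h1 x hx]
    · intro c hc c' hc' hne
      obtain ⟨x, hx, rfl⟩ := Finset.mem_image.1 hc
      obtain ⟨x', hx', rfl⟩ := Finset.mem_image.1 hc'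
      have := h2 x hx x' hx' (fun h => hne (by rw [h]))
      rw [← smul_sub, norm_smul]
      norm_num
      linarith
  let q : ℕ → Prop := fun n => ∃ s, p s ∧ s.card = n
  have h0 : q 0 := ⟨∅, ⟨by simp, by simp⟩, rfl⟩
  obtain ⟨N, hN, hcard⟩ := Nat.findGreatest_spec (P := q) (Nat.zero_le (5 ^ Module.finrank ℝ E)) h0
  refine ⟨N, hN.1, fun x hx => ?_, hp N hN⟩
  by_contra! hfar
  have hxN : x ∉ N := fun h => by
    have := hfar x h
    simp at this
    linarith
  have hins : p (insert x N) := by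
    constructor
    · intro c hc
      rcases Finset.mem_insert.1 hc with rfl | hc
      exacts [hx, hN.1 c hc]
    · intro c hc c' hc' hne
      rcases Finset.mem_insert.1 hc with rfl | hc <;>
        rcases Finset.mem_insert.1 hc' with rfl | hc'
      · exact absurd rfl hne
      · exact (hfar c' hc').le
      · rw [norm_sub_rev]
        exact (hfar c (by assumption)).le
      · exact hN.2 c hc c' hc' hne
  have hle := Nat.le_findGreatest (P := q) (hp _ hins) ⟨_, hins, rfl⟩
  rw [Finset.card_insert_of_notMem hxN] at hle
  omega

/-- A self-adjoint operator is controlled by the values of its quadratic form on a `1/2`-net. -/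
theorem ContinuousLinearMap.norm_le_of_half_net {E : Type*} [NormedAddCommGroup E]
    [InnerProductSpace ℂ E] (T : E →L[ℂ] E) (hT : T.IsSymmetric) (N : Finset E)
    (hN1 : ∀ c ∈ N, ‖c‖ = 1) (hN2 : ∀ x : E, ‖x‖ = 1 → ∃ c ∈ N, ‖x - c‖ ≤ 1 / 2) {τ : ℝ}
    (hτ0 : 0 ≤ τ) (hτ : ∀ c ∈ N, |T.reApplyInnerSelf c| ≤ τ) : ‖T‖ ≤ 32 * τ := by
  have key : ∀ x : E, ‖x‖ = 1 → |T.reApplyInnerSelf x| ≤ τ + 31 / 32 * ‖T‖ := by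
    intro x hx
    obtain ⟨c, hc, hxc⟩ := hN2 x hx
    have hc1 := hN1 c hc
    have hdiff : T.reApplyInnerSelf x - T.reApplyInnerSelf c
        = RCLike.re (inner ℂ (T (x + c)) (x - c)) := by
      have h1 : RCLike.re (inner ℂ (T c) x) = RCLike.re (inner ℂ (T x) c) := by
        have := hT c x
        simp only [ContinuousLinearMap.coe_coe] at this
        rw [this, inner_re_symm]
      simp only [ContinuousLinearMap.reApplyInnerSelf_apply, map_add, inner_add_left,
        inner_sub_right, map_sub]
      rw [h1]
      ring
    have hb : |RCLike.re (inner ℂ (T (x + c)) (x - c))| ≤ ‖T‖ * (‖x + c‖ * ‖x - c‖) := by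
      refine (RCLike.abs_re_le_norm _).trans ((norm_inner_le_norm _ _).trans ?_)
      rw [← mul_assoc]
      gcongr
      exact T.le_opNorm _
    have hpar := parallelogram_law_with_norm ℂ x c
    rw [hx, hc1] at hpar
    -- With `s = ‖x - c‖² ≤ 1/4`, the parallelogram law gives `s (4 - s) ≤ 15/16 < (31/32)²`. The
    -- triangle inequality would give only `1`, and `‖T‖` could not be absorbed.
    have hprod : ‖x + c‖ * ‖x - c‖ ≤ 31 / 32 := by
      have h1 : 0 ≤ ‖x + c‖ := norm_nonneg _
      have h2 : 0 ≤ ‖x - c‖ := norm_nonneg _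
      have h3 : ‖x - c‖ ^ 2 ≤ 1 / 4 := by nlinarith
      apply le_of_sq_le_sq _ (by norm_num)
      rw [mul_pow]
      have h4 : ‖x + c‖ ^ 2 = 4 - ‖x - c‖ ^ 2 := by nlinarith
      rw [h4]
      nlinarith [sq_nonneg (‖x - c‖)]
    have : ‖T‖ * (‖x + c‖ * ‖x - c‖) ≤ ‖T‖ * (31 / 32) := by gcongr
    have h5 := hτ c hc
    rw [← hdiff] at hb
    have h6 := abs_sub_abs_le_abs_sub (T.reApplyInnerSelf x) (T.reApplyInnerSelf c)
    linarith
  have hle : ‖T‖ ≤ τ + 31 / 32 * ‖T‖ := by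
    conv_lhs => rw [T.norm_eq_iSup_rayleighQuotient hT]
    apply ciSup_le
    intro x
    by_cases hx : x = 0
    · subst hx
      simp only [ContinuousLinearMap.rayleighQuotient_apply_zero, abs_zero]
      positivity
    · have hx' : (0 : ℝ) < ‖x‖ := norm_pos_iff.2 hx
      have h7 := key (((‖x‖⁻¹ : ℝ) : ℂ) • x) (by
        rw [norm_smul]; simp [hx'.ne'])
      rw [T.reApplyInnerSelf_smul] at h7
      have hr : T.rayleighQuotient x = ‖((‖x‖⁻¹ : ℝ) : ℂ)‖ ^ 2 * T.reApplyInnerSelf x := by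
        simp [ContinuousLinearMap.rayleighQuotient, div_eq_inv_mul]
      rw [hr]
      exact h7
  linarith

/-- A quadratic form `∑ |⟨u_j, x⟩|²` that is close to `n` on a `1/2`-net of the sphere is close
to `n ‖x‖²` everywhere. -/
theorem abs_sum_inner_sq_sub_le_of_half_net {E : Type*} [NormedAddCommGroup E]
    [InnerProductSpace ℂ E] {J : Type*} (s : Finset J) (u : J → E) (n : ℝ) (N : Finset E)
    (hN1 : ∀ c ∈ N, ‖c‖ = 1) (hN2 : ∀ x : E, ‖x‖ = 1 → ∃ c ∈ N, ‖x - c‖ ≤ 1 / 2) {τ : ℝ}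
    (hτ0 : 0 ≤ τ) (hτ : ∀ c ∈ N, |∑ j ∈ s, ‖inner ℂ (u j) c‖ ^ 2 - n| ≤ τ) (x : E) :
    |∑ j ∈ s, ‖inner ℂ (u j) x‖ ^ 2 - n * ‖x‖ ^ 2| ≤ 32 * τ * ‖x‖ ^ 2 := by
  let T : E →L[ℂ] E := ∑ j ∈ s, InnerProductSpace.rankOne ℂ (u j) (u j)
    - ((n : ℝ) : ℂ) • ContinuousLinearMap.id ℂ E
  have hTapp : ∀ x, T x = ∑ j ∈ s, inner ℂ (u j) x • u j - ((n : ℝ) : ℂ) • x := by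
    intro x
    simp [T]
  have hT : T.IsSymmetric := by
    intro x y
    simp only [ContinuousLinearMap.coe_coe, hTapp, inner_sub_left, inner_sub_right, sum_inner,
      inner_sum, inner_smul_left, inner_smul_right, inner_conj_symm, Complex.conj_ofReal]
    congr 1
    exact Finset.sum_congr rfl fun j _ => mul_comm _ _
  have hTq : ∀ x, T.reApplyInnerSelf x = ∑ j ∈ s, ‖inner ℂ (u j) x‖ ^ 2 - n * ‖x‖ ^ 2 := by
    intro x
    rw [ContinuousLinearMap.reApplyInnerSelf_apply, hTapp, inner_sub_left, sum_inner, map_sub,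
      map_sum]
    congr 1
    · refine Finset.sum_congr rfl fun j _ => ?_
      rw [inner_smul_left, RCLike.conj_mul]
      norm_cast
    · rw [inner_smul_left, Complex.conj_ofReal, RCLike.re_to_complex, Complex.re_ofReal_mul]
      congr 1
      exact inner_self_eq_norm_sq (𝕜 := ℂ) x
  have hnorm := T.norm_le_of_half_net hT N hN1 hN2 hτ0 (fun c hc => by
    rw [hTq, hN1 c hc]
    simpa using hτ c hc)
  rw [← hTq]
  calc |T.reApplyInnerSelf x| ≤ ‖T x‖ * ‖x‖ :=
        (RCLike.abs_re_le_norm _).trans (norm_inner_le_norm _ _)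
    _ ≤ ‖T‖ * ‖x‖ * ‖x‖ := by gcongr; exact T.le_opNorm x
    _ ≤ 32 * τ * ‖x‖ ^ 2 := by rw [mul_assoc, ← sq]; gcongr

/-! ### Exponential moments of linear forms in random phases. -/

/-- The moment `E exp (g² / 2)` of a centred Gaussian `g` of variance `1/4`. -/
noncomputable def gaussianSqExpMoment : ℝ :=
  ∫ g, Real.exp (g ^ 2 / 2) ∂(gaussianReal 0 (1 / 4))

theorem integrable_exp_sq_gaussianReal :
    Integrable (fun g : ℝ => Real.exp (g ^ 2 / 2)) (gaussianReal 0 (1 / 4)) := by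
  have hv : (1 / 4 : NNReal) ≠ 0 := by norm_num
  rw [gaussianReal_of_var_ne_zero _ hv, gaussianPDF_def,
    integrable_withDensity_iff_integrable_smul₀' (by fun_prop) (by simp)]
  -- The density decays like `exp (-2 g²)`, leaving `exp (-(3/2) g²)`.
  have hint := (integrable_exp_neg_mul_sq (b := 3 / 2) (by norm_num)).const_mul
    ((√(2 * Real.pi * ((1 / 4 : NNReal) : ℝ)))⁻¹)
  refine hint.congr (Filter.Eventually.of_forall fun g => ?_)
  simp only [smul_eq_mul]
  rw [ENNReal.toReal_ofReal (gaussianPDFReal_nonneg _ _ _), gaussianPDFReal,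
    mul_assoc (√(2 * Real.pi * ((1 / 4 : NNReal) : ℝ)))⁻¹, ← Real.exp_add]
  congr 2
  push_cast
  ring

/-- A sub-Gaussian variable with parameter `1` has a bounded square-exponential moment. -/
theorem ProbabilityTheory.HasSubgaussianMGF.integral_exp_sq_le {Ω : Type*} [MeasurableSpace Ω]
    {P : Measure Ω} [SFinite P] {X : Ω → ℝ} (hX : HasSubgaussianMGF X 1 P) (hm : Measurable X) :
    Integrable (fun x => Real.exp (X x ^ 2 / 8)) P ∧
      ∫ x, Real.exp (X x ^ 2 / 8) ∂P ≤ gaussianSqExpMoment := by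
  -- The square is linearized by an auxiliary Gaussian `g`: `exp (X² / 8)` is the mean of `exp (X
  -- g)`. After Tonelli the sub-Gaussian bound applies for each fixed `g`.
  have hgauss : ∀ t : ℝ, ENNReal.ofReal (Real.exp (t ^ 2 / 8))
      = ∫⁻ g, ENNReal.ofReal (Real.exp (t * g)) ∂(gaussianReal 0 (1 / 4)) := by
    intro t
    rw [← ofReal_integral_eq_lintegral_ofReal (integrable_exp_mul_gaussianReal t)
      (Filter.Eventually.of_forall fun g => (Real.exp_pos _).le)]
    have := congrFun (mgf_fun_id_gaussianReal (μ := 0) (v := 1 / 4)) t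
    rw [mgf] at this
    rw [this]
    congr 2
    push_cast
    ring
  have hswap : ∫⁻ x, ENNReal.ofReal (Real.exp (X x ^ 2 / 8)) ∂P
      ≤ ENNReal.ofReal gaussianSqExpMoment := by
    calc ∫⁻ x, ENNReal.ofReal (Real.exp (X x ^ 2 / 8)) ∂P
        = ∫⁻ x, ∫⁻ g, ENNReal.ofReal (Real.exp (X x * g)) ∂(gaussianReal 0 (1 / 4)) ∂P := by
          simp_rw [hgauss]
      _ = ∫⁻ g, ∫⁻ x, ENNReal.ofReal (Real.exp (X x * g)) ∂P ∂(gaussianReal 0 (1 / 4)) := by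
          apply lintegral_lintegral_swap
          fun_prop
      _ ≤ ∫⁻ g, ENNReal.ofReal (Real.exp (g ^ 2 / 2)) ∂(gaussianReal 0 (1 / 4)) := by
          apply lintegral_mono
          intro g
          simp only
          simp_rw [mul_comm _ g]
          rw [← ofReal_integral_eq_lintegral_ofReal (hX.integrable_exp_mul g)
            (Filter.Eventually.of_forall fun x => (Real.exp_pos _).le)]
          apply ENNReal.ofReal_le_ofReal
          have := hX.mgf_le g
          rw [mgf] at this
          simpa using this
      _ = ENNReal.ofReal gaussianSqExpMoment := by
          rw [gaussianSqExpMoment, ofReal_integral_eq_lintegral_ofReal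
            integrable_exp_sq_gaussianReal
            (Filter.Eventually.of_forall fun x => (Real.exp_pos _).le)]
  have hint : Integrable (fun x => Real.exp (X x ^ 2 / 8)) P := by
    refine ⟨by fun_prop, ?_⟩
    rw [hasFiniteIntegral_iff_ofReal (Filter.Eventually.of_forall fun x => (Real.exp_pos _).le)]
    exact hswap.trans_lt ENNReal.ofReal_lt_top
  refine ⟨hint, ?_⟩
  rw [← ofReal_integral_eq_lintegral_ofReal hint
    (Filter.Eventually.of_forall fun x => (Real.exp_pos _).le)] at hswap
  exact (ENNReal.ofReal_le_ofReal_iff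
    (integral_nonneg fun _ => (Real.exp_pos _).le)).1 hswap

section LinearForms

variable {Ω : Type*} [MeasurableSpace Ω] {P : Measure Ω} [IsProbabilityMeasure P]
  {ι : Type*} [Fintype ι] {u : ι → Ω → ℂ} {w : ι → ℂ}

/-- Hoeffding's lemma on `[-‖z‖, ‖z‖]`: the proxy is the squared half-length. -/
theorem hasSubgaussianMGF_re_mul {v : Ω → ℂ} (hm : Measurable v) (hv : ∀ x, ‖v x‖ = 1)
    (h0 : ∫ x, v x ∂P = 0) (z : ℂ) :
    HasSubgaussianMGF (fun x => (z * v x).re) (‖z‖₊ ^ 2) P := by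
  have hint : Integrable v P :=
    Integrable.of_bound hm.aestronglyMeasurable 1 (Filter.Eventually.of_forall fun x => (hv x).le)
  have h := hasSubgaussianMGF_of_mem_Icc_of_integral_eq_zero (μ := P)
    (X := fun x => (z * v x).re) (a := -‖z‖) (b := ‖z‖) (by fun_prop)
    (Filter.Eventually.of_forall fun x => by
      rw [Set.mem_Icc, ← abs_le]
      refine (Complex.abs_re_le_norm _).trans ?_
      rw [norm_mul, hv, mul_one])
    (by
      have := integral_re (𝕜 := ℂ) (hint.const_mul z)
      simp only [RCLike.re_to_complex] at this
      rw [this, integral_const_mul, h0]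
      simp)
  convert h using 1
  congr 1
  ext
  simp only [coe_nnnorm, NNReal.coe_div, Real.norm_eq_abs]
  rw [sub_neg_eq_add, ← two_mul, abs_of_nonneg (by positivity)]
  simp

theorem hasSubgaussianMGF_re_sum_mul (hm : ∀ i, Measurable (u i)) (hu : ∀ i x, ‖u i x‖ = 1)
    (h0 : ∀ i, ∫ x, u i x ∂P = 0) (hi : iIndepFun u P) (hw : ∑ i, ‖w i‖ ^ 2 = 1) :
    HasSubgaussianMGF (fun x => (∑ i, w i * u i x).re) 1 P := by
  have h := HasSubgaussianMGF.sum_of_iIndepFun (μ := P) (X := fun i x => (w i * u i x).re)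
    (c := fun i => ‖w i‖₊ ^ 2) (s := Finset.univ)
    (hi.comp (fun i z => (w i * z).re) (fun i => by fun_prop))
    (fun i _ => hasSubgaussianMGF_re_mul (hm i) (hu i) (h0 i) (w i))
  have h1 : ∑ i, ‖w i‖₊ ^ 2 = 1 := by
    ext
    push_cast
    exact hw
  rw [h1] at h
  simpa only [Complex.re_sum] using h

/-- Real and imaginary parts are each sub-Gaussian but may be dependent; `2ab ≤ a² + b²` separates
them, at the price of `16` in place of `8`. -/
theorem integral_exp_norm_sq_le (hm : ∀ i, Measurable (u i)) (hu : ∀ i x, ‖u i x‖ = 1)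
    (h0 : ∀ i, ∫ x, u i x ∂P = 0) (hi : iIndepFun u P) (hw : ∑ i, ‖w i‖ ^ 2 = 1) :
    Integrable (fun x => Real.exp (‖∑ i, w i * u i x‖ ^ 2 / 16)) P ∧
      ∫ x, Real.exp (‖∑ i, w i * u i x‖ ^ 2 / 16) ∂P ≤ gaussianSqExpMoment := by
  have hre := (hasSubgaussianMGF_re_sum_mul hm hu h0 hi hw).integral_exp_sq_le (by fun_prop)
  -- The imaginary part is the real part of the form with weights `-i w`.
  have him := (hasSubgaussianMGF_re_sum_mul (w := fun i => -Complex.I * w i) hm hu h0 hi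
    (by simpa using hw)).integral_exp_sq_le (by fun_prop)
  have him' : ∀ x, (∑ i, -Complex.I * w i * u i x).re = (∑ i, w i * u i x).im := by
    intro x
    simp_rw [mul_assoc]
    rw [← Finset.mul_sum]
    simp
  simp_rw [him'] at him
  have hpt : ∀ x, Real.exp (‖∑ i, w i * u i x‖ ^ 2 / 16)
      ≤ (1 / 2) * (Real.exp ((∑ i, w i * u i x).re ^ 2 / 8)
        + Real.exp ((∑ i, w i * u i x).im ^ 2 / 8)) := by
    intro x
    set z := ∑ i, w i * u i x
    have hz : ‖z‖ ^ 2 / 16 = z.re ^ 2 / 16 + z.im ^ 2 / 16 := by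
      rw [← Complex.normSq_eq_norm_sq, Complex.normSq_apply]
      ring
    have h1 : Real.exp (z.re ^ 2 / 8) = Real.exp (z.re ^ 2 / 16) ^ 2 := by
      rw [← Real.exp_nat_mul]; congr 1; push_cast; ring
    have h2 : Real.exp (z.im ^ 2 / 8) = Real.exp (z.im ^ 2 / 16) ^ 2 := by
      rw [← Real.exp_nat_mul]; congr 1; push_cast; ring
    rw [hz, h1, h2, Real.exp_add]
    nlinarith [sq_nonneg (Real.exp (z.re ^ 2 / 16) - Real.exp (z.im ^ 2 / 16))]
  have hsum := (hre.1.add him.1).const_mul (1 / 2)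
  have hint : Integrable (fun x => Real.exp (‖∑ i, w i * u i x‖ ^ 2 / 16)) P := by
    refine hsum.mono' (by fun_prop) (Filter.Eventually.of_forall fun x => ?_)
    rw [Real.norm_eq_abs, abs_of_pos (Real.exp_pos _)]
    exact hpt x
  refine ⟨hint, (integral_mono hint hsum hpt).trans ?_⟩
  rw [integral_const_mul]
  have h := integral_add hre.1 him.1
  have h' : ∫ x, ((fun x => Real.exp ((∑ i, w i * u i x).re ^ 2 / 8))
      + (fun x => Real.exp ((∑ i, w i * u i x).im ^ 2 / 8))) x ∂P
      ≤ gaussianSqExpMoment + gaussianSqExpMoment := by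
    simp only [Pi.add_apply]
    rw [h]
    linarith [hre.2, him.2]
  linarith

/-- Variances add for the real and for the imaginary part. For each `i` the two together give `‖w
i‖²`, because `u i` has modulus `1`; nothing about `E u²` is needed. -/
theorem integral_norm_sum_mul_sq (hm : ∀ i, Measurable (u i)) (hu : ∀ i x, ‖u i x‖ = 1)
    (h0 : ∀ i, ∫ x, u i x ∂P = 0) (hi : iIndepFun u P) (hw : ∑ i, ‖w i‖ ^ 2 = 1) :
    ∫ x, ‖∑ i, w i * u i x‖ ^ 2 ∂P = 1 := by
  have hbd : ∀ (w : ι → ℂ) i, MemLp (fun x => (w i * u i x).re) 2 P := fun w i =>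
    MemLp.of_bound (by fun_prop) ‖w i‖ (Filter.Eventually.of_forall fun x => by
      refine (Complex.abs_re_le_norm _).trans ?_
      rw [norm_mul, hu, mul_one])
  have hmean : ∀ (w : ι → ℂ) i, ∫ x, (w i * u i x).re ∂P = 0 := fun w i => by
    have hint : Integrable (u i) P := Integrable.of_bound (hm i).aestronglyMeasurable 1
      (Filter.Eventually.of_forall fun x => (hu i x).le)
    have := integral_re (𝕜 := ℂ) (hint.const_mul (w i))
    simp only [RCLike.re_to_complex] at this
    rw [this, integral_const_mul, h0]
    simp
  have hvar : ∀ w : ι → ℂ, ∫ x, (∑ i, w i * u i x).re ^ 2 ∂P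
      = ∑ i, ∫ x, (w i * u i x).re ^ 2 ∂P := by
    intro w
    have hind : iIndepFun (fun i x => (w i * u i x).re) P :=
      hi.comp (fun i z => (w i * z).re) (fun i => by fun_prop)
    have h := IndepFun.variance_sum (s := Finset.univ) (fun i _ => hbd w i)
      (fun i _ j _ hij => hind.indepFun hij)
    rw [variance_of_integral_eq_zero (by fun_prop) (by
      simp only [Finset.sum_apply]
      rw [integral_finsetSum _ (fun i _ => (hbd w i).integrable (by norm_num))]
      exact Finset.sum_eq_zero fun i _ => hmean w i)] at h
    simp only [Finset.sum_apply, ← Complex.re_sum] at h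
    rw [h]
    exact Finset.sum_congr rfl fun i _ =>
      variance_of_integral_eq_zero (by fun_prop) (hmean w i)
  have him' : ∀ x, (∑ i, -Complex.I * w i * u i x).re = (∑ i, w i * u i x).im := by
    intro x
    simp_rw [mul_assoc]
    rw [← Finset.mul_sum]
    simp
  have h1 := hvar w
  have h2 := hvar (fun i => -Complex.I * w i)
  simp_rw [him'] at h2
  have hL : ∀ w : ι → ℂ, MemLp (fun x => (∑ i, w i * u i x).re) 2 P := by
    intro w
    have := memLp_finsetSum (μ := P) (p := 2) Finset.univ (fun i _ => hbd w i)
    simpa only [Complex.re_sum] using this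
  have hL2 := hL (fun i => -Complex.I * w i)
  simp_rw [him'] at hL2
  calc ∫ x, ‖∑ i, w i * u i x‖ ^ 2 ∂P
      = ∫ x, ((∑ i, w i * u i x).re ^ 2 + (∑ i, w i * u i x).im ^ 2) ∂P := by
        congr 1 with x
        rw [← Complex.normSq_eq_norm_sq, Complex.normSq_apply]
        ring
    _ = ∑ i, (∫ x, (w i * u i x).re ^ 2 ∂P + ∫ x, (-Complex.I * w i * u i x).re ^ 2 ∂P) := by
        rw [integral_add (hL w).integrable_sq hL2.integrable_sq, h1, h2, Finset.sum_add_distrib]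
    _ = ∑ i, ‖w i‖ ^ 2 := by
        refine Finset.sum_congr rfl fun i _ => ?_
        rw [← integral_add (hbd w i).integrable_sq
          (hbd (fun i => -Complex.I * w i) i).integrable_sq]
        have : ∀ x, (w i * u i x).re ^ 2 + (-Complex.I * w i * u i x).re ^ 2 = ‖w i‖ ^ 2 := by
          intro x
          have h3 : (-Complex.I * w i * u i x).re = (w i * u i x).im := by
            rw [mul_assoc]; simp
          have h4 : ‖w i‖ = ‖w i * u i x‖ := by rw [norm_mul, hu, mul_one]
          rw [h3, h4, ← Complex.normSq_eq_norm_sq, Complex.normSq_apply]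
          ring
        simp_rw [this]
        simp
    _ = 1 := hw

end LinearForms

/-! ### Bernstein bounds and concentration of the Gram operator. -/

/-- A second-order bound for the moment generating function of a centred variable with a
bounded exponential moment. -/
theorem mgf_le_exp_of_integral_exp_abs_le {Ω : Type*} [MeasurableSpace Ω]
    {P : Measure Ω} [IsProbabilityMeasure P] {Y : Ω → ℝ} (hY : Measurable Y)
    (h0 : ∫ x, Y x ∂P = 0) (hYi : Integrable Y P) {K : ℝ}
    (hexp : Integrable (fun x => Real.exp (|Y x| / 16)) P)
    (hK : ∫ x, Real.exp (|Y x| / 16) ∂P ≤ K) {t : ℝ} (ht : |t| ≤ 1 / 32) :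
    Integrable (fun x => Real.exp (t * Y x)) P ∧ mgf Y P t ≤ Real.exp (2048 * K * t ^ 2) := by
  have hint : Integrable (fun x => Real.exp (t * Y x)) P := by
    refine hexp.mono' (by fun_prop) (Filter.Eventually.of_forall fun x => ?_)
    rw [Real.norm_eq_abs, abs_of_pos (Real.exp_pos _), Real.exp_le_exp]
    refine (le_abs_self _).trans ?_
    rw [abs_mul]
    nlinarith [abs_nonneg (Y x)]
  refine ⟨hint, ?_⟩
  -- Start from `e^y ≤ 1 + y + y² e^|y|` with `y = tY`. Half of the available exponent absorbs `Y² ≤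
  -- 2 · 32² e^(|Y|/32)`, the other half `e^(|tY|)`.
  have hpt : ∀ x, Real.exp (t * Y x) ≤ 1 + t * Y x + 2048 * t ^ 2 * Real.exp (|Y x| / 16) := by
    intro x
    have h1 := Complex.norm_exp_sub_sum_le_norm_mul_exp ((t * Y x : ℝ) : ℂ) 2
    rw [Finset.sum_range_succ, Finset.sum_range_one, ← Complex.ofReal_exp] at h1
    have h2 : ((Real.exp (t * Y x) : ℝ) : ℂ)
        - (((t * Y x : ℝ) : ℂ) ^ 0 / (Nat.factorial 0 : ℂ)
          + ((t * Y x : ℝ) : ℂ) ^ 1 / (Nat.factorial 1 : ℂ))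
        = ((Real.exp (t * Y x) - (1 + t * Y x) : ℝ) : ℂ) := by
      push_cast
      simp
    rw [h2, Complex.norm_real, Complex.norm_real, Real.norm_eq_abs, Real.norm_eq_abs, abs_mul] at h1
    have h3 : (|Y x| / 32) ^ 2 / 2 ≤ Real.exp (|Y x| / 32) := by
      have := Real.quadratic_le_exp_of_nonneg (x := |Y x| / 32) (by positivity)
      have h4 : 0 ≤ |Y x| / 32 := by positivity
      linarith
    have h5 : Real.exp (|t| * |Y x|) ≤ Real.exp (|Y x| / 32) := by
      rw [Real.exp_le_exp]
      nlinarith [abs_nonneg (Y x)]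
    have h6 : Real.exp (|Y x| / 16) = Real.exp (|Y x| / 32) * Real.exp (|Y x| / 32) := by
      rw [← Real.exp_add]; congr 1; ring
    have h7 : (|t| * |Y x|) ^ 2 * Real.exp (|t| * |Y x|)
        ≤ 2048 * t ^ 2 * Real.exp (|Y x| / 16) := by
      have h8 : (|t| * |Y x|) ^ 2 ≤ 2048 * t ^ 2 * Real.exp (|Y x| / 32) := by
        rw [mul_pow, sq_abs t]
        nlinarith [sq_nonneg t]
      rw [h6, ← mul_assoc]
      exact mul_le_mul h8 h5 (Real.exp_pos _).le (by positivity)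
    have h9 := le_abs_self (Real.exp (t * Y x) - (1 + t * Y x))
    linarith
  have h1 : Integrable (fun x => 1 + t * Y x) P := (integrable_const 1).add (hYi.const_mul t)
  have h2 : Integrable (fun x => 2048 * t ^ 2 * Real.exp (|Y x| / 16)) P := hexp.const_mul _
  calc mgf Y P t ≤ ∫ x, (1 + t * Y x + 2048 * t ^ 2 * Real.exp (|Y x| / 16)) ∂P :=
        integral_mono hint (h1.add h2) hpt
    _ = 1 + 2048 * t ^ 2 * ∫ x, Real.exp (|Y x| / 16) ∂P := by
        rw [integral_add h1 h2, integral_add (integrable_const 1) (hYi.const_mul t),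
          integral_const_mul, integral_const_mul, h0]
        simp
    _ ≤ 1 + 2048 * K * t ^ 2 := by
        nlinarith [mul_le_mul_of_nonneg_left hK (by positivity : (0 : ℝ) ≤ 2048 * t ^ 2)]
    _ ≤ Real.exp (2048 * K * t ^ 2) := by
        linarith [Real.add_one_le_exp (2048 * K * t ^ 2)]

/-- Blocks of an independent family are independent. -/
theorem ProbabilityTheory.iIndepFun.curry {Ω ι κ 𝓧 : Type*} [MeasurableSpace Ω]
    [MeasurableSpace 𝓧] {P : Measure Ω} {X : ι → κ → Ω → 𝓧} (mX : ∀ i j, Measurable (X i j))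
    (h : iIndepFun (fun (p : ι × κ) => X p.1 p.2) P) : iIndepFun (fun i x j => X i j x) P := by
  have := h.isProbabilityMeasure
  have hσ : iIndepFun (fun (p : (_ : ι) × κ) x => X p.1 p.2 x) P :=
    h.precomp (Equiv.sigmaEquivProd ι κ).injective
  have hrow : ∀ i, iIndepFun (X i) P := fun i =>
    h.precomp (g := fun j => (i, j)) (fun _ _ hj => (Prod.mk.inj hj).2)
  have : ∀ i j, IsProbabilityMeasure (P.map (X i j)) :=
    fun i j => Measure.isProbabilityMeasure_map (mX i j).aemeasurable
  -- Independence says that the joint law is a product measure, and currying turns a product over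
  -- pairs into a product of products.
  have hcurry : (MeasurableEquiv.piCurry fun (_ : ι) (_ : κ) => 𝓧) ∘ (fun x p => X p.1 p.2 x)
      = fun x i j => X i j x := by
    ext
    simp [Sigma.curry]
  rw [iIndepFun_iff_map_fun_eq_infinitePi_map (by fun_prop)] at hσ ⊢
  rw [← hcurry, ← Measure.map_map (by fun_prop) (by fun_prop), hσ,
    Measure.infinitePi_map_piCurry (fun i j => P.map (X i j))]
  congrm Measure.infinitePi fun i => ?_
  rw [(iIndepFun_iff_map_fun_eq_infinitePi_map (by fun_prop)).1 (hrow i)]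

/-- The variance proxy in the Bernstein-type bound for `|⟨c, u⟩|² - 1`. -/
noncomputable def phaseVarianceProxy : ℝ :=
  2048 * (gaussianSqExpMoment * Real.exp (1 / 16))

theorem one_le_gaussianSqExpMoment : 1 ≤ gaussianSqExpMoment := by
  have h := integral_mono (integrable_const (1 : ℝ)) integrable_exp_sq_gaussianReal
    (fun g => Real.one_le_exp (by positivity : (0 : ℝ) ≤ g ^ 2 / 2))
  rw [gaussianSqExpMoment]
  simpa only [integral_const, probReal_univ, one_smul] using h

theorem le_phaseVarianceProxy : 2048 ≤ phaseVarianceProxy := by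
  have h1 := one_le_gaussianSqExpMoment
  have h2 : (1 : ℝ) ≤ Real.exp (1 / 16) := Real.one_le_exp (by norm_num)
  have h3 : 1 ≤ gaussianSqExpMoment * Real.exp (1 / 16) := one_le_mul_of_one_le_of_one_le h1 h2
  rw [phaseVarianceProxy]
  linarith

/-- Centring by the mean `1` costs the factor `e^(1/16)` in the exponential moment, whence the form
of `phaseVarianceProxy`. -/
theorem mgf_norm_sum_mul_sq_sub_one_le {Ω : Type*} [MeasurableSpace Ω] {P : Measure Ω}
    [IsProbabilityMeasure P] {ι : Type*} [Fintype ι] {u : ι → Ω → ℂ} {w : ι → ℂ}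
    (hm : ∀ i, Measurable (u i)) (hu : ∀ i x, ‖u i x‖ = 1)
    (h0 : ∀ i, ∫ x, u i x ∂P = 0) (hi : iIndepFun u P) (hw : ∑ i, ‖w i‖ ^ 2 = 1)
    {t : ℝ} (ht : |t| ≤ 1 / 32) :
    Integrable (fun x => Real.exp (t * (‖∑ i, w i * u i x‖ ^ 2 - 1))) P ∧
      mgf (fun x => ‖∑ i, w i * u i x‖ ^ 2 - 1) P t ≤ Real.exp (phaseVarianceProxy * t ^ 2) := by
  have hE := integral_exp_norm_sq_le hm hu h0 hi hw
  have hmean := integral_norm_sum_mul_sq hm hu h0 hi hw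
  -- A non-integrable function has Bochner integral `0`, so the value `1` already proves
  -- integrability.
  have hsq : Integrable (fun x => ‖∑ i, w i * u i x‖ ^ 2) P :=
    Integrable.of_integral_ne_zero (by rw [hmean]; norm_num)
  have hpt : ∀ x, Real.exp (|‖∑ i, w i * u i x‖ ^ 2 - 1| / 16)
      ≤ Real.exp (1 / 16) * Real.exp (‖∑ i, w i * u i x‖ ^ 2 / 16) := by
    intro x
    rw [← Real.exp_add, Real.exp_le_exp]
    have : |‖∑ i, w i * u i x‖ ^ 2 - 1| ≤ 1 + ‖∑ i, w i * u i x‖ ^ 2 := by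
      rw [abs_le]
      constructor <;> nlinarith [sq_nonneg ‖∑ i, w i * u i x‖]
    linarith
  have hint : Integrable (fun x => Real.exp (|‖∑ i, w i * u i x‖ ^ 2 - 1| / 16)) P := by
    refine (hE.1.const_mul (Real.exp (1 / 16))).mono' (by fun_prop)
      (Filter.Eventually.of_forall fun x => ?_)
    rw [Real.norm_eq_abs, abs_of_pos (Real.exp_pos _)]
    exact hpt x
  refine mgf_le_exp_of_integral_exp_abs_le (by fun_prop) ?_ (hsq.sub (integrable_const 1)) hint ?_ ht
  · simp only [Pi.sub_apply]
    rw [integral_sub hsq (integrable_const 1), hmean]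
    simp
  · refine (integral_mono hint (hE.1.const_mul _) hpt).trans ?_
    rw [integral_const_mul, mul_comm]
    gcongr
    exact hE.2

/-- Two-sided Bernstein bound for a sum of independent variables. -/
theorem measureReal_le_abs_sum_le {Ω : Type*} [MeasurableSpace Ω] {P : Measure Ω}
    [IsProbabilityMeasure P] {J : Type*} {Y : J → Ω → ℝ} (hY : ∀ j, Measurable (Y j))
    (hi : iIndepFun Y P) {V : ℝ} (hV : 16 ≤ V)
    (hmgf : ∀ j t, |t| ≤ 1 / 32 →
      Integrable (fun x => Real.exp (t * Y j x)) P ∧ mgf (Y j) P t ≤ Real.exp (V * t ^ 2))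
    (s : Finset J) {τ : ℝ} (hτ0 : 0 ≤ τ) (hτ1 : τ ≤ 1) :
    P.real {x | τ * s.card ≤ |∑ j ∈ s, Y j x|}
      ≤ 2 * Real.exp (-(τ ^ 2 * s.card / (4 * V))) := by
  have hV0 : 0 < V := by linarith
  -- `|t| = τ / (2V)` minimizes `-|t| τ + V t²`; `16 ≤ V` and `τ ≤ 1` keep it within `1/32`. The
  -- form in `|t|` serves both tails.
  have hbound : ∀ t, |t| = τ / (2 * V) → Real.exp (-(|t| * (τ * s.card)))
      * mgf (∑ j ∈ s, Y j) P t ≤ Real.exp (-(τ ^ 2 * s.card / (4 * V))) := by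
    intro t ht
    have ht' : |t| ≤ 1 / 32 := by
      rw [ht, div_le_iff₀ (by positivity)]
      linarith
    rw [hi.mgf_sum hY]
    calc Real.exp (-(|t| * (τ * s.card))) * ∏ j ∈ s, mgf (Y j) P t
        ≤ Real.exp (-(|t| * (τ * s.card))) * ∏ j ∈ s, Real.exp (V * t ^ 2) := by
          gcongr with j hj
          · exact fun j _ => mgf_nonneg
          · exact (hmgf j t ht').2
      _ = Real.exp (-(τ ^ 2 * s.card / (4 * V))) := by
          rw [Finset.prod_const, ← Real.exp_nat_mul, ← Real.exp_add, ← sq_abs, ht]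
          congr 1
          field_simp
          ring
  have ht0 : 0 ≤ τ / (2 * V) := by positivity
  have habs : |τ / (2 * V)| = τ / (2 * V) := abs_of_nonneg ht0
  have habs' : |-(τ / (2 * V))| = τ / (2 * V) := by rw [abs_neg, habs]
  have hle : τ / (2 * V) ≤ 1 / 32 := by
    rw [div_le_iff₀ (by positivity)]
    linarith
  have h1 := measure_ge_le_exp_mul_mgf (μ := P) (X := ∑ j ∈ s, Y j) (τ * s.card) ht0
    (hi.integrable_exp_mul_sum hY fun j _ => (hmgf j _ (habs.trans_le hle)).1)
  have h2 := measure_le_le_exp_mul_mgf (μ := P) (X := ∑ j ∈ s, Y j) (-(τ * s.card))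
    (neg_nonpos.2 ht0)
    (hi.integrable_exp_mul_sum hY fun j _ => (hmgf j _ (habs'.trans_le hle)).1)
  have h1' := hbound _ habs
  have h2' := hbound _ habs'
  rw [habs] at h1'
  rw [habs'] at h2'
  have hsub : {x | τ * s.card ≤ |∑ j ∈ s, Y j x|} ⊆
      {x | τ * s.card ≤ (∑ j ∈ s, Y j) x} ∪ {x | (∑ j ∈ s, Y j) x ≤ -(τ * s.card)} := by
    intro x hx
    simp only [Set.mem_union, Set.mem_ofPred_eq, Finset.sum_apply] at hx ⊢
    rcases le_abs.1 hx with h | h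
    · exact Or.inl h
    · exact Or.inr (by linarith)
  calc P.real {x | τ * s.card ≤ |∑ j ∈ s, Y j x|}
      ≤ P.real {x | τ * s.card ≤ (∑ j ∈ s, Y j) x}
        + P.real {x | (∑ j ∈ s, Y j) x ≤ -(τ * s.card)} :=
        (measureReal_mono hsub).trans (measureReal_union_le _ _)
    _ ≤ 2 * Real.exp (-(τ ^ 2 * s.card / (4 * V))) := by
        rw [neg_mul] at h1
        rw [neg_neg, mul_neg] at h2
        linarith

/-- The Gram operator of `n` random phase vectors in dimension `d` is close to `n` times the
identity. -/
theorem measure_exists_lt_abs_sum_norm_sq_sub_le {Ω : Type*} [MeasurableSpace Ω] {P : Measure Ω}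
    [IsProbabilityMeasure P] {J : Type*} {d : ℕ} {u : J → Fin d → Ω → ℂ}
    (hm : ∀ j i, Measurable (u j i)) (hu : ∀ j i x, ‖u j i x‖ = 1)
    (h0 : ∀ j i, ∫ x, u j i x ∂P = 0) (hi : iIndepFun (fun (p : J × Fin d) => u p.1 p.2) P)
    (s : Finset J) {τ : ℝ} (hτ0 : 0 ≤ τ) (hτ1 : τ ≤ 1) :
    P {x | ∃ c : Fin d → ℂ, 32 * (τ * s.card) * ∑ i, ‖c i‖ ^ 2
        < |∑ j ∈ s, ‖∑ i, star (c i) * u j i x‖ ^ 2 - s.card * ∑ i, ‖c i‖ ^ 2|}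
      ≤ ENNReal.ofReal
        (25 ^ d * (2 * Real.exp (-(τ ^ 2 * s.card / (4 * phaseVarianceProxy))))) := by
  obtain ⟨N, hN1, hN2, hNcard⟩ := exists_half_net_sphere (EuclideanSpace ℂ (Fin d))
  have hfin : Module.finrank ℝ (EuclideanSpace ℂ (Fin d)) = 2 * d := by
    rw [finrank_real_of_complex]
    simp
  -- The real dimension is `2d`, so the net has at most `5^(2d) = 25^d` points.
  rw [hfin, pow_mul] at hNcard
  norm_num at hNcard
  have hinner : ∀ (c : EuclideanSpace ℂ (Fin d)) (v : Fin d → ℂ),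
      ‖inner ℂ (WithLp.toLp 2 v : EuclideanSpace ℂ (Fin d)) c‖ = ‖∑ i, star (c i) * v i‖ := by
    intro c v
    rw [norm_inner_symm, PiLp.inner_apply]
    congr 1
    refine Finset.sum_congr rfl fun i _ => ?_
    simp [mul_comm]
  have hnorm : ∀ c : EuclideanSpace ℂ (Fin d), ‖c‖ ^ 2 = ∑ i, ‖c i‖ ^ 2 :=
    fun c => EuclideanSpace.norm_sq_eq c
  have hpoint : ∀ c ∈ N, P {x | τ * s.card ≤ |∑ j ∈ s, (‖∑ i, star (c i) * u j i x‖ ^ 2 - 1)|}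
      ≤ ENNReal.ofReal (2 * Real.exp (-(τ ^ 2 * s.card / (4 * phaseVarianceProxy)))) := by
    intro c hc
    have hw : ∑ i, ‖star (c i)‖ ^ 2 = 1 := by
      simp_rw [norm_star]
      rw [← hnorm, hN1 c hc, one_pow]
    rw [← ofReal_measureReal]
    apply ENNReal.ofReal_le_ofReal
    refine measureReal_le_abs_sum_le (Y := fun j x => ‖∑ i, star (c i) * u j i x‖ ^ 2 - 1)
      (fun j => by fun_prop) ?_ (by linarith [le_phaseVarianceProxy]) (fun j t ht => ?_) s hτ0 hτ1
    · exact (hi.curry hm).comp (fun _ v => ‖∑ i, star (c i) * v i‖ ^ 2 - 1)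
        (fun _ => by fun_prop)
    · exact mgf_norm_sum_mul_sq_sub_one_le (hm j) (hu j) (h0 j)
        (hi.precomp (g := fun i => (j, i)) fun _ _ h => (Prod.mk.inj h).2) hw ht
  have hsub : {x | ∃ c : Fin d → ℂ, 32 * (τ * s.card) * ∑ i, ‖c i‖ ^ 2
        < |∑ j ∈ s, ‖∑ i, star (c i) * u j i x‖ ^ 2 - s.card * ∑ i, ‖c i‖ ^ 2|} ⊆
      ⋃ c ∈ N, {x | τ * s.card ≤ |∑ j ∈ s, (‖∑ i, star (c i) * u j i x‖ ^ 2 - 1)|} := by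
    rintro x ⟨c, hc⟩
    by_contra hx
    simp only [Set.mem_iUnion, Set.mem_ofPred_eq, not_exists, not_le] at hx
    have h := abs_sum_inner_sq_sub_le_of_half_net s
      (fun j => (WithLp.toLp 2 (fun i => u j i x) : EuclideanSpace ℂ (Fin d))) s.card N hN1 hN2
      (τ := τ * s.card) (by positivity) (fun c hc => by
        have := (hx c hc).le
        simp only [Finset.sum_sub_distrib, Finset.sum_const, nsmul_eq_mul, mul_one] at this
        simpa only [hinner] using this) (WithLp.toLp 2 c)
    simp only [hinner, hnorm] at h
    exact absurd hc (not_lt.2 h)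
  calc _ ≤ P (⋃ c ∈ N, {x | τ * s.card ≤ |∑ j ∈ s, (‖∑ i, star (c i) * u j i x‖ ^ 2 - 1)|}) :=
        measure_mono hsub
    _ ≤ ∑ c ∈ N, P {x | τ * s.card ≤ |∑ j ∈ s, (‖∑ i, star (c i) * u j i x‖ ^ 2 - 1)|} :=
        measure_biUnion_finset_le _ _
    _ ≤ ∑ c ∈ N, ENNReal.ofReal
          (2 * Real.exp (-(τ ^ 2 * s.card / (4 * phaseVarianceProxy)))) :=
        Finset.sum_le_sum hpoint
    _ ≤ _ := by
        rw [Finset.sum_const, nsmul_eq_mul, ENNReal.ofReal_mul (p := 25 ^ d) (by positivity)]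
        have h25 : (N.card : ENNReal) ≤ ENNReal.ofReal (25 ^ d) := by
          rw [← ENNReal.ofReal_natCast]
          exact ENNReal.ofReal_le_ofReal (by exact_mod_cast hNcard)
        gcongr

/-! ### Mutual information and likelihood ratios. -/

/-- Gibbs' inequality. -/
theorem sum_negMulLog_le_neg_sum_mul_log {ι : Type*} [Fintype ι] {p r : ι → ℝ}
    (hp : ∀ i, 0 ≤ p i) (hr : ∀ i, 0 ≤ r i) (hpr : ∀ i, r i = 0 → p i = 0)
    (hsum : ∑ i, r i ≤ ∑ i, p i) :
    ∑ i, Real.negMulLog (p i) ≤ -∑ i, p i * Real.log (r i) := by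
  have hpt : ∀ i, Real.negMulLog (p i) ≤ -(p i * Real.log (r i)) + (r i - p i) := by
    intro i
    rcases (hp i).eq_or_lt with h | h
    · rw [← h]
      simpa using hr i
    · have hri : 0 < r i := (hr i).lt_of_ne fun h' => h.ne' (hpr i h'.symm)
      have := Real.log_le_sub_one_of_pos (div_pos hri h)
      rw [Real.log_div hri.ne' h.ne'] at this
      have h2 := mul_le_mul_of_nonneg_left this h.le
      have h3 : p i * (r i / p i - 1) = r i - p i := by field_simp
      rw [h3] at h2
      rw [Real.negMulLog]
      linarith
  calc ∑ i, Real.negMulLog (p i) ≤ ∑ i, (-(p i * Real.log (r i)) + (r i - p i)) :=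
        Finset.sum_le_sum fun i _ => hpt i
    _ ≤ -∑ i, p i * Real.log (r i) := by
        rw [Finset.sum_add_distrib, Finset.sum_sub_distrib, Finset.sum_neg_distrib]
        linarith

/-- A log-sum inequality for a mixture `r ∑ w_m t_m` with total weight `∑ w_m`. -/
theorem mul_log_mixture_le {μ : Type*} [Fintype μ] {w t : μ → ℝ} (hw : ∀ m, 0 ≤ w m)
    (ht : ∀ m, 0 ≤ t m) {r : ℝ} (hr : 0 ≤ r) :
    (r * ∑ m, w m * t m) * Real.log (r * ∑ m, w m * t m)
        - (r * ∑ m, w m * t m) * Real.log (∑ m, w m) - (r * ∑ m, w m * t m) * Real.log r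
      ≤ r * ∑ m, w m * (t m * Real.log (t m)) := by
  rcases hr.eq_or_lt with rfl | hr
  · simp
  rcases (Finset.sum_nonneg fun m (_ : m ∈ Finset.univ) => hw m).eq_or_lt with h0 | hW
  · have hz : ∀ m, w m = 0 := fun m =>
      (Finset.sum_eq_zero_iff_of_nonneg fun m _ => hw m).1 h0.symm m (Finset.mem_univ m)
    simp [hz]
  set W := ∑ m, w m with hWdef
  -- Jensen for `t log t` with the normalized weights `w m / W`.
  have hJ := Real.convexOn_mul_log.map_sum_le (t := Finset.univ) (w := fun m => w m / W) (p := t)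
    (fun m _ => div_nonneg (hw m) hW.le) (by rw [← Finset.sum_div, ← hWdef, div_self hW.ne'])
    (fun m _ => ht m)
  simp only [smul_eq_mul] at hJ
  set τ := ∑ m, w m / W * t m with hτ
  have hs : ∑ m, w m * t m = W * τ := by
    rw [hτ, Finset.mul_sum]
    refine Finset.sum_congr rfl fun m _ => ?_
    field_simp
  have hs' : ∑ m, w m * (t m * Real.log (t m))
      = W * ∑ m, w m / W * (t m * Real.log (t m)) := by
    rw [Finset.mul_sum]
    refine Finset.sum_congr rfl fun m _ => ?_
    field_simp
  have hτ0 : 0 ≤ τ := Finset.sum_nonneg fun m _ => mul_nonneg (div_nonneg (hw m) hW.le) (ht m)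
  rw [hs, hs']
  rcases hτ0.eq_or_lt with h | h
  · rw [← h] at hJ ⊢
    simp only [zero_mul, mul_zero, sub_zero] at hJ ⊢
    positivity
  · rw [Real.log_mul hr.ne' (by positivity), Real.log_mul hW.ne' h.ne']
    have := mul_le_mul_of_nonneg_left hJ (mul_nonneg hr.le hW.le)
    nlinarith

/-- The mutual information of a joint distribution, expressed by the likelihood ratios `t m y` of
the outcome `y` against a reference distribution `r`, is at most the mean of `t log t`. -/
theorem mutualInformation_mul_log_two_le {α β μ : Type*} [Fintype α] [Fintype β] [Fintype μ]
    {p : α × β → ℝ} {w : α → μ → ℝ} {t : μ → β → ℝ} {r : β → ℝ} (hw : ∀ x m, 0 ≤ w x m)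
    (ht : ∀ m y, 0 ≤ t m y) (hr : ∀ y, 0 ≤ r y) (hr1 : ∑ y, r y = 1)
    (hrt : ∀ m, ∑ y, r y * t m y = 1) (hw1 : ∑ x, ∑ m, w x m = 1)
    (hp : ∀ x y, p (x, y) = r y * ∑ m, w x m * t m y) :
    mutualInformation p * Real.log 2
      ≤ ∑ y, r y * ∑ m, (∑ x, w x m) * (t m y * Real.log (t m y)) := by
  have hlog : Real.log 2 ≠ 0 := (Real.log_pos one_lt_two).ne'
  have hpx : ∀ x, ∑ y, p (x, y) = ∑ m, w x m := by
    intro x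
    simp_rw [hp, Finset.mul_sum]
    rw [Finset.sum_comm]
    refine Finset.sum_congr rfl fun m _ => ?_
    calc ∑ y, r y * (w x m * t m y) = w x m * ∑ y, r y * t m y := by
          rw [Finset.mul_sum]
          exact Finset.sum_congr rfl fun y _ => by ring
      _ = w x m := by rw [hrt, mul_one]
  have hp0 : ∀ x y, 0 ≤ p (x, y) := fun x y => by
    rw [hp]
    exact mul_nonneg (hr y) (Finset.sum_nonneg fun m _ => mul_nonneg (hw x m) (ht m y))
  -- Gibbs replaces Eve's true marginal by `r`, after which every term involves only ratios to `r`.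
  have hG := sum_negMulLog_le_neg_sum_mul_log (p := fun y => ∑ x, p (x, y)) (r := r)
    (fun y => Finset.sum_nonneg fun x _ => hp0 x y) hr
    (fun y hy => Finset.sum_eq_zero fun x _ => by rw [hp, hy, zero_mul])
    (by rw [Finset.sum_comm, hr1]; simp_rw [hpx]; exact hw1.ge)
  have hX : ∑ x, Real.negMulLog (∑ y, p (x, y))
      = -∑ y, ∑ x, p (x, y) * Real.log (∑ m, w x m) := by
    rw [Finset.sum_comm, ← Finset.sum_neg_distrib]
    refine Finset.sum_congr rfl fun x _ => ?_
    rw [← Finset.sum_mul, hpx, Real.negMulLog]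
    ring
  have hXY : ∑ xy, Real.negMulLog (p xy) = -∑ y, ∑ x, p (x, y) * Real.log (p (x, y)) := by
    rw [Fintype.sum_prod_type, Finset.sum_comm]
    simp only [Real.negMulLog, neg_mul, Finset.sum_neg_distrib]
  have hterm : ∀ x y, p (x, y) * Real.log (p (x, y)) - p (x, y) * Real.log (∑ m, w x m)
      - p (x, y) * Real.log (r y) ≤ r y * ∑ m, w x m * (t m y * Real.log (t m y)) := by
    intro x y
    rw [hp]
    exact mul_log_mixture_le (hw x) (fun m => ht m y) (hr y)
  have hmain : ∑ y, ∑ x, (p (x, y) * Real.log (p (x, y)) - p (x, y) * Real.log (∑ m, w x m)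
      - p (x, y) * Real.log (r y)) ≤ ∑ y, ∑ x, r y * ∑ m, w x m * (t m y * Real.log (t m y)) :=
    Finset.sum_le_sum fun y _ => Finset.sum_le_sum fun x _ => hterm x y
  have hR : ∀ y, ∑ x, r y * ∑ m, w x m * (t m y * Real.log (t m y))
      = r y * ∑ m, (∑ x, w x m) * (t m y * Real.log (t m y)) := by
    intro y
    rw [← Finset.mul_sum, Finset.sum_comm]
    simp_rw [Finset.sum_mul]
  simp_rw [hR] at hmain
  simp only [Finset.sum_sub_distrib] at hmain
  simp only [Finset.sum_mul] at hG
  rw [mutualInformation, shannonEntropy, shannonEntropy, shannonEntropy, ← add_div, ← sub_div,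
    div_mul_cancel₀ _ hlog, hX, hXY]
  linarith

/-! ### Averages of `t log t`. -/

theorem mul_log_le_mul_log_of_le {t D : ℝ} (ht : 0 ≤ t) (htD : t ≤ D) :
    t * Real.log t ≤ t * Real.log D := by
  rcases ht.eq_or_lt with rfl | h
  · simp
  · exact mul_le_mul_of_nonneg_left (Real.log_le_log h htD) ht

/-- The convex function `t log t` lies below its chord over `[1, D]`, of slope `D log D / (D - 1)`,
and `D / (D - 1) ≤ 2`. -/
theorem mul_log_le_two_mul_log_mul_sub_one {t D : ℝ} (ht : 1 ≤ t) (htD : t ≤ D) (hD : 2 ≤ D) :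
    t * Real.log t ≤ 2 * Real.log D * (t - 1) := by
  have hD1 : 0 < D - 1 := by linarith
  have hlog : 0 ≤ Real.log D := Real.log_nonneg (by linarith)
  have h := Real.convexOn_mul_log.2 (Set.mem_Ici.2 zero_le_one)
    (Set.mem_Ici.2 (by linarith : (0 : ℝ) ≤ D))
    (div_nonneg (by linarith) hD1.le : 0 ≤ (D - t) / (D - 1))
    (div_nonneg (by linarith) hD1.le : 0 ≤ (t - 1) / (D - 1)) (by field_simp; ring)
  have h1 : ((D - t) / (D - 1)) • (1 : ℝ) + ((t - 1) / (D - 1)) • D = t := by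
    simp only [smul_eq_mul]
    field_simp
    ring
  rw [h1] at h
  simp only [smul_eq_mul, Real.log_one, mul_zero, zero_add] at h
  refine h.trans ?_
  rw [div_mul_eq_mul_div, div_le_iff₀ hD1]
  nlinarith [mul_nonneg (mul_nonneg (sub_nonneg.2 ht) hlog) (by linarith : (0 : ℝ) ≤ D - 2)]

/-- The linear term `t - 1` is kept so that it averages to zero. For `t ≤ 1` the left side is
nonpositive and `η` or the indicator keeps the right side nonnegative. -/
theorem mul_log_le_of_le {t D η : ℝ} (ht : 0 ≤ t) (htD : t ≤ D) (hD : 2 ≤ D) (hη : 0 ≤ η) :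
    t * Real.log t ≤ 2 * Real.log D * (t - 1 + η + if t < 1 - η then 1 else 0) := by
  have hlog : 0 ≤ Real.log D := Real.log_nonneg (by linarith)
  rcases le_total 1 t with h | h
  · refine (mul_log_le_two_mul_log_mul_sub_one h htD hD).trans ?_
    gcongr
    split_ifs <;> linarith
  · refine (mul_nonpos_of_nonneg_of_nonpos ht (Real.log_nonpos ht h)).trans ?_
    apply mul_nonneg (by positivity)
    split_ifs with h' <;> linarith

section Averages

variable {β : Type*} [Fintype β] {M : ℕ} {t : Fin M → β → ℝ} {r : β → ℝ} {D : ℝ}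

theorem sum_mul_log_le_log (hM : 0 < M) (ht : ∀ m y, 0 ≤ t m y) (htD : ∀ m y, t m y ≤ D)
    (hr : ∀ y, 0 ≤ r y) (hrt : ∀ m, ∑ y, r y * t m y = 1) :
    ∑ y, r y * ∑ m, (M : ℝ)⁻¹ * (t m y * Real.log (t m y)) ≤ Real.log D := by
  have hM' : (M : ℝ) ≠ 0 := by positivity
  calc ∑ y, r y * ∑ m, (M : ℝ)⁻¹ * (t m y * Real.log (t m y))
      ≤ ∑ y, r y * ∑ m, (M : ℝ)⁻¹ * (t m y * Real.log D) := by
        refine Finset.sum_le_sum fun y _ => mul_le_mul_of_nonneg_left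
          (Finset.sum_le_sum fun m _ => mul_le_mul_of_nonneg_left ?_ (by positivity)) (hr y)
        exact mul_log_le_mul_log_of_le (ht m y) (htD m y)
    _ = ∑ m : Fin M, (M : ℝ)⁻¹ * Real.log D * ∑ y, r y * t m y := by
        simp_rw [Finset.mul_sum]
        rw [Finset.sum_comm]
        exact Finset.sum_congr rfl fun m _ => Finset.sum_congr rfl fun y _ => by ring
    _ = Real.log D := by
        simp_rw [hrt]
        simp
        field_simp

theorem sum_mul_log_le_of_card_le (hM : 0 < M) (hD : 2 ≤ D) (ht : ∀ m y, 0 ≤ t m y)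
    (htD : ∀ m y, t m y ≤ D) (hr : ∀ y, 0 ≤ r y) (hr1 : ∑ y, r y = 1)
    (hrt : ∀ m, ∑ y, r y * t m y = 1) {η δ : ℝ} (hη : 0 ≤ η)
    (hbad : ∀ y, ((Finset.univ.filter fun m => t m y < 1 - η).card : ℝ) ≤ δ * M) :
    ∑ y, r y * ∑ m, (M : ℝ)⁻¹ * (t m y * Real.log (t m y)) ≤ 2 * (η + δ) * Real.log D := by
  have hM' : (M : ℝ) ≠ 0 := by positivity
  have hlog : 0 ≤ Real.log D := Real.log_nonneg (by linarith)
  calc ∑ y, r y * ∑ m, (M : ℝ)⁻¹ * (t m y * Real.log (t m y))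
      ≤ ∑ y, r y * ∑ m, (M : ℝ)⁻¹
          * (2 * Real.log D * (t m y - 1 + η + if t m y < 1 - η then 1 else 0)) := by
        refine Finset.sum_le_sum fun y _ => mul_le_mul_of_nonneg_left
          (Finset.sum_le_sum fun m _ => mul_le_mul_of_nonneg_left ?_ (by positivity)) (hr y)
        exact mul_log_le_of_le (ht m y) (htD m y) hD hη
    _ = 2 * Real.log D * ((M : ℝ)⁻¹ * (∑ m, ∑ y, r y * t m y) - (∑ y, r y) + η * (∑ y, r y)
          + ∑ y, r y * ((M : ℝ)⁻¹ * (Finset.univ.filter fun m => t m y < 1 - η).card)) := by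
        rw [Finset.sum_comm]
        simp only [Finset.card_filter, Nat.cast_sum, Finset.mul_sum, ← Finset.sum_add_distrib,
          ← Finset.sum_sub_distrib]
        refine Finset.sum_congr rfl fun y _ => ?_
        have h1 : r y = ∑ m : Fin M, (M : ℝ)⁻¹ * r y := by
          simp
          field_simp
        conv_rhs => rw [mul_add, mul_add, mul_sub]
        conv_rhs =>
          enter [1, 1, 2, 2]
          rw [h1]
        conv_rhs =>
          enter [1, 2, 2, 2]
          rw [h1]
        simp only [Finset.mul_sum, ← Finset.sum_add_distrib, ← Finset.sum_sub_distrib]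
        refine Finset.sum_congr rfl fun m _ => ?_
        push_cast
        ring
    _ ≤ 2 * Real.log D * (η + δ) := by
        refine mul_le_mul_of_nonneg_left ?_ (by positivity)
        have h2 : ∑ y, r y * ((M : ℝ)⁻¹ * (Finset.univ.filter fun m => t m y < 1 - η).card)
            ≤ ∑ y, r y * δ := by
          gcongr with y _
          · exact hr y
          · rw [inv_mul_le_iff₀ (by positivity), mul_comm]
            exact hbad y
        rw [← Finset.sum_mul, hr1] at h2
        simp_rw [hrt, hr1]
        simp only [Finset.sum_const, Finset.card_univ, Fintype.card_fin, nsmul_eq_mul, mul_one]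
        rw [inv_mul_cancel₀ hM']
        linarith
    _ = 2 * (η + δ) * Real.log D := by ring

end Averages

/-! ### Eve's measurement on the codewords. -/

/-- Alice's register is diagonal, so only the diagonal entries of her effects matter: her outcome is
a noisy function of `m`. -/
theorem jointOutcome_lockingState {d M K : ℕ} (ψ : Fin M → Fin K → Fin d → ℂ)
    (S : Finset (Fin K)) {n n' : ℕ} (A : POVM (Fin M) n) (E : POVM (Fin d) n') (x : Fin n)
    (y : Fin n') :
    jointOutcome (lockingState ψ S) A E (x, y)
      = ∑ m, (M : ℝ)⁻¹ * (A.effect x m m).re * ((S.card : ℝ)⁻¹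
          * ∑ k ∈ S, (star (ψ m k) ⬝ᵥ (E.effect y *ᵥ ψ m k)).re) := by
  have hA : ∀ m, A.effect x m m = (((A.effect x m m).re : ℝ) : ℂ) := fun m => by
    have := (A.posSemidef x).diag_nonneg (i := m)
    exact (Complex.eq_re_of_ofReal_le (r := 0) (by simpa using this))
  have hE : ∀ v : Fin d → ℂ, star v ⬝ᵥ (E.effect y *ᵥ v)
      = (((star v ⬝ᵥ (E.effect y *ᵥ v)).re : ℝ) : ℂ) := fun v => by
    have := (E.posSemidef y).dotProduct_mulVec_nonneg v
    exact (Complex.eq_re_of_ofReal_le (r := 0) (by simpa using this))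
  have htr : Matrix.trace (lockingState ψ S * (A.effect x ⊗ₖ E.effect y))
      = ∑ m, (M : ℂ)⁻¹ * A.effect x m m * ((S.card : ℂ)⁻¹
          * ∑ k ∈ S, star (ψ m k) ⬝ᵥ (E.effect y *ᵥ ψ m k)) := by
    rw [lockingState, Matrix.smul_mul, Matrix.trace_smul, Finset.sum_mul, Matrix.trace_sum,
      smul_eq_mul, Finset.mul_sum]
    refine Finset.sum_congr rfl fun m _ => ?_
    rw [← Matrix.mul_kronecker_mul, Matrix.trace_kronecker, Matrix.trace_single_mul,
      Matrix.smul_mul, Matrix.trace_smul, Finset.sum_mul, Matrix.trace_sum, smul_eq_mul, one_mul,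
      mul_assoc]
    congr 3
    refine Finset.sum_congr rfl fun k _ => ?_
    rw [Matrix.vecMulVec_mul, Matrix.trace_vecMulVec, Matrix.dotProduct_mulVec, dotProduct_comm]
  rw [jointOutcome, htr]
  have hcast : (∑ m, (M : ℂ)⁻¹ * A.effect x m m * ((S.card : ℂ)⁻¹
          * ∑ k ∈ S, star (ψ m k) ⬝ᵥ (E.effect y *ᵥ ψ m k)))
      = ((∑ m, (M : ℝ)⁻¹ * (A.effect x m m).re * ((S.card : ℝ)⁻¹
          * ∑ k ∈ S, (star (ψ m k) ⬝ᵥ (E.effect y *ᵥ ψ m k)).re) : ℝ) : ℂ) := by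
    push_cast
    refine Finset.sum_congr rfl fun m _ => ?_
    rw [← hA]
    congr 2
    exact Finset.sum_congr rfl fun k _ => hE _
  rw [hcast, Complex.ofReal_re]

theorem re_dotProduct_conjTranspose_mul_self {ι : Type*} [Fintype ι] (B : Matrix ι ι ℂ)
    (v : ι → ℂ) :
    (star v ⬝ᵥ ((Bᴴ * B) *ᵥ v)).re = ∑ i, ‖∑ j, B i j * v j‖ ^ 2 := by
  rw [← Matrix.mulVec_mulVec, Matrix.dotProduct_mulVec, ← Matrix.star_mulVec, dotProduct,
    Complex.re_sum]
  refine Finset.sum_congr rfl fun i _ => ?_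
  rw [Pi.star_apply, RCLike.star_def, ← Complex.normSq_eq_conj_mul_self, Complex.ofReal_re,
    Complex.normSq_eq_norm_sq]
  rfl

open scoped MatrixOrder in
theorem Matrix.PosSemidef.exists_eq_conjTranspose_mul_self {ι : Type*} [Fintype ι] [DecidableEq ι]
    {X : Matrix ι ι ℂ} (hX : X.PosSemidef) : ∃ B : Matrix ι ι ℂ, X = Bᴴ * B :=
  CStarAlgebra.nonneg_iff_eq_star_mul_self.1 (Matrix.nonneg_iff_posSemidef.2 hX)

theorem re_trace_conjTranspose_mul_self {ι : Type*} [Fintype ι] (B : Matrix ι ι ℂ) :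
    (Bᴴ * B).trace.re = ∑ i, ∑ j, ‖B i j‖ ^ 2 := by
  rw [Finset.sum_comm, Matrix.trace, Complex.re_sum]
  refine Finset.sum_congr rfl fun j _ => ?_
  rw [Matrix.diag_apply, Matrix.mul_apply, Complex.re_sum]
  refine Finset.sum_congr rfl fun i _ => ?_
  rw [Matrix.conjTranspose_apply, RCLike.star_def, ← Complex.normSq_eq_conj_mul_self,
    Complex.ofReal_re, Complex.normSq_eq_norm_sq]

theorem norm_sum_mul_sq_le_card_mul {d : ℕ} (b : Fin d → ℂ) {u : Fin d → ℂ}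
    (hu : ∀ i, ‖u i‖ = 1) : ‖∑ i, b i * u i‖ ^ 2 ≤ d * ∑ i, ‖b i‖ ^ 2 := by
  have h1 : ‖∑ i, b i * u i‖ ≤ ∑ i, ‖b i‖ := by
    refine (norm_sum_le _ _).trans_eq (Finset.sum_congr rfl fun i _ => ?_)
    rw [norm_mul, hu, mul_one]
  calc ‖∑ i, b i * u i‖ ^ 2 ≤ (∑ i, ‖b i‖) ^ 2 := by gcongr
    _ ≤ d * ∑ i, ‖b i‖ ^ 2 := by
      simpa using sq_sum_le_card_mul_sum_sq (s := Finset.univ) (f := fun i => ‖b i‖)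

theorem norm_phase (θ : ℝ) : ‖Complex.exp (Complex.I * θ)‖ = 1 := by
  rw [mul_comm]
  exact Complex.norm_exp_ofReal_mul_I θ

theorem re_dotProduct_phaseVector {d : ℕ} (B : Matrix (Fin d) (Fin d) ℂ) (θ : Fin d → ℝ) :
    (star (phaseVector θ) ⬝ᵥ ((Bᴴ * B) *ᵥ phaseVector θ)).re
      = (d : ℝ)⁻¹ * ∑ i, ‖∑ j, B i j * Complex.exp (Complex.I * θ j)‖ ^ 2 := by
  rw [re_dotProduct_conjTranspose_mul_self, Finset.mul_sum]
  refine Finset.sum_congr rfl fun i _ => ?_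
  have h : ∑ j, B i j * phaseVector θ j = ((1 / Real.sqrt d : ℝ) : ℂ)
      * ∑ j, B i j * Complex.exp (Complex.I * θ j) := by
    rw [Finset.mul_sum]
    refine Finset.sum_congr rfl fun j _ => ?_
    rw [phaseVector]
    ring
  rw [h, norm_mul, mul_pow, Complex.norm_real, Real.norm_eq_abs, sq_abs, div_pow, one_pow,
    Real.sq_sqrt (by positivity), one_div]

/-- Lower frame bound for the codewords: for every set of `ℓ` messages, the Gram operator of the
codewords with key in `S` is at least `1 - η` times its mean. -/
def HasLowerFrameBound {d M K : ℕ} (θ : Fin M → Fin K → Fin d → ℝ) (S : Finset (Fin K))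
    (ℓ : ℕ) (η : ℝ) : Prop :=
  ∀ T : Finset (Fin M), T.card = ℓ → ∀ c : Fin d → ℂ,
    (1 - η) * (ℓ * S.card) * ∑ i, ‖c i‖ ^ 2
      ≤ ∑ m ∈ T, ∑ k ∈ S, ‖∑ i, star (c i) * Complex.exp (Complex.I * θ m k i)‖ ^ 2

/-- Likelihood ratios of the outcomes of a measurement by Eve, with respect to the outcome
distribution `tr E_y / d` of the maximally mixed state. -/
theorem exists_likelihoodRatio {d M K : ℕ} (hd : 0 < d) (hM : 0 < M)
    (θ : Fin M → Fin K → Fin d → ℝ) {S : Finset (Fin K)} (hS : S.Nonempty) {n n' : ℕ}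
    (A : POVM (Fin M) n) (E : POVM (Fin d) n') :
    ∃ (r : Fin n' → ℝ) (t : Fin M → Fin n' → ℝ), (∀ y, 0 ≤ r y) ∧ ∑ y, r y = 1 ∧
      (∀ m y, 0 ≤ t m y) ∧ (∀ m y, t m y ≤ d) ∧ (∀ m, ∑ y, r y * t m y = 1) ∧
      mutualInformation (jointOutcome (lockingState (fun m k => phaseVector (θ m k)) S) A E)
          * Real.log 2 ≤ ∑ y, r y * ∑ m, (M : ℝ)⁻¹ * (t m y * Real.log (t m y)) ∧
      ∀ (ℓ : ℕ) (η : ℝ), 0 < ℓ → 0 ≤ η → HasLowerFrameBound θ S ℓ η →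
        ∀ y, (Finset.univ.filter fun m => t m y < 1 - η).card < ℓ := by
  have hd' : (d : ℝ) ≠ 0 := by positivity
  have hd1 : (1 : ℝ) ≤ d := by exact_mod_cast hd
  have hM' : (M : ℝ) ≠ 0 := by positivity
  have hSc : (0 : ℝ) < S.card := by exact_mod_cast hS.card_pos
  have hB : ∀ y, ∃ B : Matrix (Fin d) (Fin d) ℂ, E.effect y = Bᴴ * B := fun y =>
    (E.posSemidef y).exists_eq_conjTranspose_mul_self
  choose B hB using hB
  let e : Fin M → Fin K → Fin n' → ℝ := fun m k y =>
    ∑ i, ‖∑ j, B y i j * Complex.exp (Complex.I * θ m k j)‖ ^ 2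
  let τ : Fin n' → ℝ := fun y => ∑ i, ∑ j, ‖B y i j‖ ^ 2
  have hτ0 : ∀ y, 0 ≤ τ y := fun y => by positivity
  have he0 : ∀ m k y, 0 ≤ e m k y := fun m k y => by positivity
  have heτ : ∀ m k y, e m k y ≤ d * τ y := fun m k y => by
    simp only [e, τ]
    rw [Finset.mul_sum]
    exact Finset.sum_le_sum fun i _ => norm_sum_mul_sq_le_card_mul _ fun j => norm_phase _
  have hτ1 : ∑ y, τ y = d := by
    have h := congrArg (fun X => X.trace.re) E.sum_eq_one
    simp only [Matrix.trace_sum, Complex.re_sum, Matrix.trace_one, Fintype.card_fin,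
      Complex.natCast_re] at h
    rw [← h]
    refine Finset.sum_congr rfl fun y _ => ?_
    rw [hB, re_trace_conjTranspose_mul_self]
  have hψ : ∀ m k y, (star (phaseVector (θ m k)) ⬝ᵥ (E.effect y *ᵥ phaseVector (θ m k))).re
      = (d : ℝ)⁻¹ * e m k y := fun m k y => by
    rw [hB, re_dotProduct_phaseVector]
  have he1 : ∀ m k, ∑ y, e m k y = d := by
    intro m k
    have h1 : ∑ y, (star (phaseVector (θ m k)) ⬝ᵥ (E.effect y *ᵥ phaseVector (θ m k))).re
        = (star (phaseVector (θ m k)) ⬝ᵥ phaseVector (θ m k)).re := by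
      rw [← Complex.re_sum, ← dotProduct_sum, ← Matrix.sum_mulVec, E.sum_eq_one,
        Matrix.one_mulVec]
    have h2 : (star (phaseVector (θ m k)) ⬝ᵥ phaseVector (θ m k)).re = 1 := by
      rw [dotProduct, Complex.re_sum]
      have : ∀ i, (star (phaseVector (θ m k)) i * phaseVector (θ m k) i).re = (d : ℝ)⁻¹ := by
        intro i
        rw [Pi.star_apply, RCLike.star_def, ← Complex.normSq_eq_conj_mul_self, Complex.ofReal_re,
          Complex.normSq_eq_norm_sq, phaseVector, norm_mul, norm_phase, mul_one,
          Complex.norm_real, Real.norm_eq_abs, sq_abs, div_pow, one_pow,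
          Real.sq_sqrt (by positivity), one_div]
      simp_rw [this]
      simp [hd']
    simp_rw [hψ] at h1
    rw [h2, ← Finset.mul_sum, inv_mul_eq_iff_eq_mul₀ hd', mul_one] at h1
    exact h1
  let r : Fin n' → ℝ := fun y => (d : ℝ)⁻¹ * τ y
  -- If `τ y = 0` the outcome never occurs; the value `1` keeps it from being counted as bad.
  let t : Fin M → Fin n' → ℝ := fun m y =>
    if τ y = 0 then 1 else (S.card : ℝ)⁻¹ * (∑ k ∈ S, e m k y) / τ y
  have hrt : ∀ m y, r y * t m y = (d : ℝ)⁻¹ * ((S.card : ℝ)⁻¹ * ∑ k ∈ S, e m k y) := by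
    intro m y
    simp only [r, t]
    split_ifs with h
    · have : ∀ k ∈ S, e m k y = 0 := fun k _ =>
        le_antisymm (by simpa [h] using heτ m k y) (he0 m k y)
      rw [Finset.sum_eq_zero this, h]
      simp
    · field_simp
  have hr0 : ∀ y, 0 ≤ r y := fun y => mul_nonneg (by positivity) (hτ0 y)
  have hr1 : ∑ y, r y = 1 := by
    simp only [r]
    rw [← Finset.mul_sum, hτ1, inv_mul_cancel₀ hd']
  have ht0 : ∀ m y, 0 ≤ t m y := by
    intro m y
    simp only [t]
    split_ifs
    · exact zero_le_one
    · exact div_nonneg (mul_nonneg (by positivity) (Finset.sum_nonneg fun k _ => he0 m k y)) (hτ0 y)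
  have htd : ∀ m y, t m y ≤ d := by
    intro m y
    simp only [t]
    split_ifs with h
    · exact hd1
    · have hτ : 0 < τ y := (hτ0 y).lt_of_ne' h
      rw [div_le_iff₀ hτ, inv_mul_le_iff₀ hSc]
      calc ∑ k ∈ S, e m k y ≤ ∑ k ∈ S, d * τ y := Finset.sum_le_sum fun k _ => heτ m k y
        _ = S.card * (d * τ y) := by rw [Finset.sum_const, nsmul_eq_mul]
  have hrt1 : ∀ m, ∑ y, r y * t m y = 1 := by
    intro m
    simp_rw [hrt]
    rw [← Finset.mul_sum, ← Finset.mul_sum, Finset.sum_comm]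
    simp_rw [he1]
    rw [Finset.sum_const, nsmul_eq_mul]
    field_simp
  have hA0 : ∀ x m, 0 ≤ (A.effect x m m).re := fun x m => by
    have := (A.posSemidef x).diag_nonneg (i := m)
    exact (Complex.le_def.1 this).1
  have hA1 : ∀ m, ∑ x, (A.effect x m m).re = 1 := fun m => by
    have h := congrArg (fun X => (X m m).re) A.sum_eq_one
    simpa [Matrix.sum_apply] using h
  have hw : ∀ m, ∑ x, (M : ℝ)⁻¹ * (A.effect x m m).re = (M : ℝ)⁻¹ := fun m => by
    rw [← Finset.mul_sum, hA1, mul_one]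
  refine ⟨r, t, hr0, hr1, ht0, htd, hrt1, ?_, ?_⟩
  · have h := mutualInformation_mul_log_two_le
      (p := jointOutcome (lockingState (fun m k => phaseVector (θ m k)) S) A E)
      (w := fun x m => (M : ℝ)⁻¹ * (A.effect x m m).re) (t := t) (r := r)
      (fun x m => mul_nonneg (by positivity) (hA0 x m)) ht0 hr0 hr1 hrt1
      (by
        rw [Finset.sum_comm]
        simp_rw [hw]
        simp [hM'])
      (fun x y => by
        rw [jointOutcome_lockingState, Finset.mul_sum]
        refine Finset.sum_congr rfl fun m _ => ?_
        rw [mul_left_comm (r y), hrt]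
        simp_rw [hψ]
        rw [← Finset.mul_sum]
        ring)
    simpa only [hw] using h
  · intro ℓ η hℓ hη hframe y
    by_contra! hcard
    -- On `ℓ` bad messages the sum of the `e m k y` is below `(1 - η) ℓ |S| τ y`, while the frame
    -- bound for the conjugated rows of `B y`, summed over rows, gives the reverse.
    obtain ⟨T, hT, hTcard⟩ := Finset.exists_subset_card_eq hcard
    have hτ : 0 < τ y := by
      refine (hτ0 y).lt_of_ne' fun h => ?_
      obtain ⟨m, hm⟩ := Finset.card_pos.1 (hTcard.symm ▸ hℓ)
      have := (Finset.mem_filter.1 (hT hm)).2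
      simp only [t, if_pos h] at this
      linarith
    have hlow : (1 - η) * (ℓ * S.card) * τ y ≤ ∑ m ∈ T, ∑ k ∈ S, e m k y := by
      calc (1 - η) * (ℓ * S.card) * τ y
          = ∑ i, (1 - η) * (ℓ * S.card) * ∑ j, ‖star (B y i j)‖ ^ 2 := by
            simp only [τ, norm_star]
            rw [Finset.mul_sum]
        _ ≤ ∑ i, ∑ m ∈ T, ∑ k ∈ S,
            ‖∑ j, star (star (B y i j)) * Complex.exp (Complex.I * θ m k j)‖ ^ 2 :=
            Finset.sum_le_sum fun i _ => hframe T hTcard fun j => star (B y i j)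
        _ = ∑ m ∈ T, ∑ k ∈ S, e m k y := by
            simp only [star_star, e]
            rw [Finset.sum_comm]
            exact Finset.sum_congr rfl fun m _ => Finset.sum_comm
    have hup : ∑ m ∈ T, ∑ k ∈ S, e m k y < ∑ m ∈ T, (1 - η) * S.card * τ y := by
      refine Finset.sum_lt_sum_of_nonempty (Finset.card_pos.1 (hTcard.symm ▸ hℓ)) fun m hm => ?_
      have h := (Finset.mem_filter.1 (hT hm)).2
      simp only [t, if_neg hτ.ne'] at h
      rw [div_lt_iff₀ hτ, inv_mul_lt_iff₀ hSc] at h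
      linarith
    rw [Finset.sum_const, nsmul_eq_mul, hTcard] at hup
    linarith

theorem eveInformation_le_of_forall {d M K : ℕ} (θ : Fin M → Fin K → Fin d → ℝ)
    (S : Finset (Fin K)) {b : ℝ} (h : ∀ (n n' : ℕ) (A : POVM (Fin M) n) (E : POVM (Fin d) n'),
      mutualInformation (jointOutcome (lockingState (fun m k => phaseVector (θ m k)) S) A E)
          * Real.log 2 ≤ b * Real.log d) :
    eveInformation θ S ≤ ((b * Real.logb 2 d : ℝ) : EReal) := by
  refine iSup_le fun n => iSup_le fun n' => iSup_le fun A => iSup_le fun E => ?_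
  rw [EReal.coe_le_coe_iff, Real.logb, ← mul_div_assoc, le_div_iff₀ (Real.log_pos one_lt_two)]
  exact h n n' A E

theorem eveInformation_le_logb {d M K : ℕ} (hd : 0 < d) (hM : 0 < M)
    (θ : Fin M → Fin K → Fin d → ℝ) {S : Finset (Fin K)} (hS : S.Nonempty) :
    eveInformation θ S ≤ ((1 * Real.logb 2 d : ℝ) : EReal) := by
  refine eveInformation_le_of_forall θ S fun n n' A E => ?_
  obtain ⟨r, t, hr, -, ht, htd, hrt, hI, -⟩ := exists_likelihoodRatio hd hM θ hS A E
  rw [one_mul]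
  exact hI.trans (sum_mul_log_le_log hM ht htd hr hrt)

theorem eveInformation_le_of_hasLowerFrameBound {d M K : ℕ} (hd : 0 < d) (hM : 0 < M)
    (θ : Fin M → Fin K → Fin d → ℝ) {S : Finset (Fin K)} (hS : S.Nonempty) {δ η : ℝ}
    (hδ : 0 < δ) (hη : 0 ≤ η) (hframe : HasLowerFrameBound θ S ⌈δ * M⌉₊ η) :
    eveInformation θ S ≤ ((2 * (η + δ) * Real.logb 2 d : ℝ) : EReal) := by
  -- The chord bound needs `D = d ≥ 2`; for `d = 1` the trivial bound is zero.
  rcases (Nat.succ_le_of_lt hd).eq_or_lt with h1 | h2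
  · have h := eveInformation_le_logb hd hM θ hS
    obtain rfl : d = 1 := h1.symm
    simpa using h
  refine eveInformation_le_of_forall θ S fun n n' A E => ?_
  obtain ⟨r, t, hr, hr1, ht, htd, hrt, hI, hbad⟩ := exists_likelihoodRatio hd hM θ hS A E
  refine hI.trans (sum_mul_log_le_of_card_le hM (by exact_mod_cast h2) ht htd hr hr1 hrt hη
    fun y => ?_)
  exact (Nat.lt_ceil.1 (hbad _ η (Nat.ceil_pos.2 (by positivity)) hη hframe y)).le

/-! ### Failure probabilities for sets of keys. -/

theorem logb_two_natCast_nonneg (d : ℕ) : 0 ≤ Real.logb 2 d := by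
  rcases Nat.eq_zero_or_pos d with rfl | h
  · simp
  · exact Real.logb_nonneg one_lt_two (by exact_mod_cast h)

/-- The deviation constant: relative deviations of the Gram operator are of order
`frameConstant * δ`. -/
noncomputable def frameConstant : ℝ := 64 * √phaseVarianceProxy

theorem le_frameConstant : 64 ≤ frameConstant := by
  have h : (1 : ℝ) ≤ √phaseVarianceProxy := by
    rw [Real.one_le_sqrt]
    linarith [le_phaseVarianceProxy]
  rw [frameConstant]
  linarith

section Ensemble

variable {Ω : Type*} [MeasurableSpace Ω] {P : Measure Ω} [IsProbabilityMeasure P] {d M K : ℕ}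
  {θ : Fin M → Fin K → Fin d → Ω → ℝ}

/-- A union bound over the `ℓ`-sets `T` of messages; for each, the `ℓ |S|` codewords indexed by `T
×ˢ S` concentrate. -/
theorem IsPhaseEnsemble.measure_not_hasLowerFrameBound_le (h : IsPhaseEnsemble P θ)
    (S : Finset (Fin K)) (ℓ : ℕ) {τ : ℝ} (hτ0 : 0 ≤ τ) (hτ1 : τ ≤ 1) :
    P {x | ¬ HasLowerFrameBound (fun m k ω => θ m k ω x) S ℓ (32 * τ)}
      ≤ ENNReal.ofReal (M.choose ℓ * (25 ^ d
        * (2 * Real.exp (-(τ ^ 2 * (ℓ * S.card) / (4 * phaseVarianceProxy)))))) := by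
  have hm : ∀ (j : Fin M × Fin K) i,
      Measurable fun x => Complex.exp (Complex.I * θ j.1 j.2 i x) := fun j i => by
    have := h.measurable j.1 j.2 i
    fun_prop
  have hi : iIndepFun (fun (p : (Fin M × Fin K) × Fin d) x =>
      Complex.exp (Complex.I * θ p.1.1 p.1.2 p.2 x)) P :=
    h.indep.precomp (g := Equiv.prodAssoc (Fin M) (Fin K) (Fin d)) (Equiv.injective _)
  let G : Finset (Fin M) → Set Ω := fun T => {x | ∃ c : Fin d → ℂ,
    32 * (τ * (T ×ˢ S).card) * ∑ i, ‖c i‖ ^ 2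
      < |∑ j ∈ T ×ˢ S, ‖∑ i, star (c i) * Complex.exp (Complex.I * θ j.1 j.2 i x)‖ ^ 2
        - (T ×ˢ S).card * ∑ i, ‖c i‖ ^ 2|}
  have hG : ∀ T ∈ Finset.powersetCard ℓ (Finset.univ : Finset (Fin M)), P (G T)
      ≤ ENNReal.ofReal (25 ^ d
        * (2 * Real.exp (-(τ ^ 2 * (ℓ * S.card) / (4 * phaseVarianceProxy))))) := by
    intro T hT
    have hc := measure_exists_lt_abs_sum_norm_sq_sub_le hm (fun j i x => norm_phase _)
      (fun j i => h.mean_zero j.1 j.2 i) hi (T ×ˢ S) hτ0 hτ1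
    have hcard : ((T ×ˢ S).card : ℝ) = ℓ * S.card := by
      rw [Finset.card_product, (Finset.mem_powersetCard.1 hT).2]
      push_cast
      ring
    rw [← hcard]
    exact hc
  have hsub : {x | ¬ HasLowerFrameBound (fun m k ω => θ m k ω x) S ℓ (32 * τ)}
      ⊆ ⋃ T ∈ Finset.powersetCard ℓ (Finset.univ : Finset (Fin M)), G T := by
    intro x hx
    simp only [Set.mem_ofPred_eq, HasLowerFrameBound, not_forall, not_le] at hx
    obtain ⟨T, hT, c, hc⟩ := hx
    simp only [Set.mem_iUnion]
    refine ⟨T, Finset.mem_powersetCard.2 ⟨Finset.subset_univ _, hT⟩, c, ?_⟩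
    rw [Finset.sum_product, Finset.card_product, hT]
    refine lt_of_lt_of_le ?_ (neg_le_abs _)
    push_cast
    linarith
  calc _ ≤ P (⋃ T ∈ Finset.powersetCard ℓ (Finset.univ : Finset (Fin M)), G T) :=
        measure_mono hsub
    _ ≤ ∑ T ∈ Finset.powersetCard ℓ (Finset.univ : Finset (Fin M)), P (G T) :=
        measure_biUnion_finset_le _ _
    _ ≤ ∑ T ∈ Finset.powersetCard ℓ (Finset.univ : Finset (Fin M)), ENNReal.ofReal (25 ^ d
        * (2 * Real.exp (-(τ ^ 2 * (ℓ * S.card) / (4 * phaseVarianceProxy))))) :=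
        Finset.sum_le_sum hG
    _ = _ := by
        rw [Finset.sum_const, Finset.card_powersetCard, Finset.card_univ, Fintype.card_fin,
          nsmul_eq_mul, ENNReal.ofReal_mul (p := (M.choose ℓ : ℝ)) (by positivity),
          ENNReal.ofReal_natCast]

end Ensemble

/-- When the locking rate is positive, the union bound over messages and net points costs less
than the gain in the exponent. -/
theorem choose_mul_exp_le_exp_neg_lockingRate {d M L : ℕ} (hd : 0 < d) (hM : 0 < M)
    {δ : ℝ} (hδ0 : 0 < δ) (hδ1 : δ ≤ 1 / 64) (hrate : 0 < lockingRate (d / M) δ M L) :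
    (M.choose ⌈δ * M⌉₊ : ℝ) * (25 ^ d * (2 * Real.exp (-(δ ^ 2 * (⌈δ * M⌉₊ * L)))))
      ≤ Real.exp (-(M * lockingRate (d / M) δ M L)) := by
  set ℓ := ⌈δ * M⌉₊
  have hM' : (0 : ℝ) < M := by exact_mod_cast hM
  have hd' : (1 : ℝ) ≤ d := by exact_mod_cast hd
  have hℓ : δ * M ≤ ℓ := Nat.le_ceil _
  have hlogM : 0 ≤ Real.log M := Real.log_natCast_nonneg M
  have hlogδ : 2 ≤ Real.log (5 / δ) := by
    rw [Real.le_log_iff_exp_le (by positivity), le_div_iff₀ hδ0]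
    have h2 : Real.exp 2 ≤ 9 := by
      have : Real.exp 2 = Real.exp 1 ^ 2 := by rw [← Real.exp_nat_mul]; norm_num
      rw [this]
      nlinarith [Real.exp_one_lt_d9, Real.exp_pos 1]
    nlinarith [Real.exp_pos 2]
  have hR : M * lockingRate (d / M) δ M L
      = M * (δ ^ 3 * L / 4) - M * (δ * Real.log M) - 2 * (d * Real.log (5 / δ)) := by
    rw [lockingRate]
    field_simp
  have hRpos : 0 < M * lockingRate (d / M) δ M L := mul_pos hM' hrate
  have hdlog : d * 2 ≤ d * Real.log (5 / δ) := by gcongr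
  have hMlog : 0 ≤ M * (δ * Real.log M) := by positivity
  rw [hR] at hRpos ⊢
  have hn : δ ^ 3 * M * L ≤ δ ^ 2 * (ℓ * L) := by
    calc δ ^ 3 * M * L = δ ^ 2 * (δ * M * L) := by ring
      _ ≤ δ ^ 2 * (ℓ * L) := by gcongr
  -- Positivity of the rate is what makes both union bounds affordable: each takes at most a quarter
  -- of the exponent `δ² ℓ L`, and the remaining half exceeds `M` times the rate.
  have hlogM' : Real.log M ≤ δ ^ 2 * L / 4 := by
    have h1 : M * δ * Real.log M ≤ M * δ * (δ ^ 2 * L / 4) := by linarith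
    exact le_of_mul_le_mul_left h1 (by positivity)
  have hchoose : (M.choose ℓ : ℝ) ≤ Real.exp (δ ^ 2 * (ℓ * L) / 4) := by
    calc (M.choose ℓ : ℝ) ≤ (M : ℝ) ^ ℓ := by exact_mod_cast Nat.choose_le_pow M ℓ
      _ = Real.exp (ℓ * Real.log M) := by rw [Real.exp_nat_mul, Real.exp_log hM']
      _ ≤ Real.exp (ℓ * (δ ^ 2 * L / 4)) := by gcongr
      _ = Real.exp (δ ^ 2 * (ℓ * L) / 4) := by congr 1; ring
  have hexp4 : (50 : ℝ) ≤ Real.exp 4 := by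
    have : Real.exp 4 = (Real.exp 1 ^ 2) ^ 2 := by
      rw [← pow_mul, ← Real.exp_nat_mul]; norm_num
    have h1 : (7.2 : ℝ) ≤ Real.exp 1 ^ 2 := by nlinarith [Real.exp_one_gt_d9]
    rw [this]
    nlinarith
  have h25 : (25 : ℝ) ^ d * 2 ≤ Real.exp (δ ^ 2 * (ℓ * L) / 4) := by
    have h2 : (2 : ℝ) ≤ 2 ^ d := by
      calc (2 : ℝ) = 2 ^ 1 := (pow_one 2).symm
        _ ≤ 2 ^ d := pow_le_pow_right₀ (by norm_num) hd
    calc (25 : ℝ) ^ d * 2 ≤ 25 ^ d * 2 ^ d := by gcongr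
      _ = 50 ^ d := by rw [← mul_pow]; norm_num
      _ ≤ Real.exp 4 ^ d := by gcongr
      _ = Real.exp (d * 4) := by rw [Real.exp_nat_mul]
      -- Here `4d ≤ 2d log (5/δ) < δ³ M L / 4`, by `hdlog` and the positive rate.
      _ ≤ Real.exp (δ ^ 2 * (ℓ * L) / 4) := by
        gcongr
        linarith
  calc (M.choose ℓ : ℝ) * (25 ^ d * (2 * Real.exp (-(δ ^ 2 * (ℓ * L)))))
      = (M.choose ℓ : ℝ) * (25 ^ d * 2) * Real.exp (-(δ ^ 2 * (ℓ * L))) := by ring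
    _ ≤ Real.exp (δ ^ 2 * (ℓ * L) / 4) * Real.exp (δ ^ 2 * (ℓ * L) / 4)
        * Real.exp (-(δ ^ 2 * (ℓ * L))) := by gcongr
    _ = Real.exp (-(δ ^ 2 * (ℓ * L) / 2)) := by
        rw [← Real.exp_add, ← Real.exp_add]
        congr 1
        ring
    _ ≤ _ := by
        gcongr
        have : 0 ≤ δ ^ 3 * M * L := by positivity
        linarith

section Locking

variable {Ω : Type*} [MeasurableSpace Ω] {P : Measure Ω} [IsProbabilityMeasure P] {d M K : ℕ}
  {θ : Fin M → Fin K → Fin d → Ω → ℝ}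

/-- A given set of `L` keys locks the message. -/
theorem IsPhaseEnsemble.measure_lt_eveInformation_le (h : IsPhaseEnsemble P θ) (hd : 0 < d)
    (hM : 0 < M) {δ : ℝ} (hδ : 0 < δ) {S : Finset (Fin K)} (hS : S.Nonempty) :
    P {x | ((2 * (frameConstant + 1) * δ * Real.logb 2 d : ℝ) : EReal)
        < eveInformation (fun m k ω => θ m k ω x) S}
      ≤ ENNReal.ofReal (Real.exp (-(M * lockingRate (d / M) δ M S.card))) := by
  have ha := le_frameConstant
  have hlogb := logb_two_natCast_nonneg d
  -- For `frameConstant * δ > 1` the claim follows from the trivial bound `log₂ d`; for a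
  -- nonpositive rate the claimed probability is at least `1`.
  rcases le_or_gt (frameConstant * δ) 1 with hsmall | hlarge
  swap
  · have hempty : {x | ((2 * (frameConstant + 1) * δ * Real.logb 2 d : ℝ) : EReal)
        < eveInformation (fun m k ω => θ m k ω x) S} = ∅ := by
      ext x
      simp only [Set.mem_ofPred_eq, Set.mem_empty_iff_false, iff_false, not_lt]
      refine (eveInformation_le_logb hd hM _ hS).trans ?_
      rw [EReal.coe_le_coe_iff]
      gcongr
      nlinarith
    rw [hempty]
    simp
  rcases le_or_gt (lockingRate (d / M) δ M S.card) 0 with hrate | hrate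
  · refine prob_le_one.trans ?_
    rw [ENNReal.one_le_ofReal]
    apply Real.one_le_exp
    nlinarith [(by positivity : (0 : ℝ) ≤ M)]
  have hδ1 : δ ≤ 1 / 64 := by nlinarith
  have hV : 0 < phaseVarianceProxy := by linarith [le_phaseVarianceProxy]
  -- This `τ` turns the Bernstein exponent `τ² n / (4V)` into `δ² n`, and the net constant `32` then
  -- gives `η = frameConstant * δ`.
  have hτ : 32 * (2 * √phaseVarianceProxy * δ) = frameConstant * δ := by
    rw [frameConstant]
    ring
  have hbound := h.measure_not_hasLowerFrameBound_le S ⌈δ * M⌉₊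
    (τ := 2 * √phaseVarianceProxy * δ) (by positivity) (by linarith)
  rw [hτ] at hbound
  have hexp : (2 * √phaseVarianceProxy * δ) ^ 2 * (⌈δ * M⌉₊ * S.card) / (4 * phaseVarianceProxy)
      = δ ^ 2 * (⌈δ * M⌉₊ * S.card) := by
    rw [mul_pow, mul_pow, Real.sq_sqrt hV.le]
    field_simp
    ring
  rw [hexp] at hbound
  refine (measure_mono fun x hx => ?_).trans (hbound.trans (ENNReal.ofReal_le_ofReal
    (choose_mul_exp_le_exp_neg_lockingRate hd hM hδ hδ1 hrate)))
  simp only [Set.mem_ofPred_eq] at hx ⊢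
  intro hframe
  have := eveInformation_le_of_hasLowerFrameBound hd hM _ hS hδ (by positivity) hframe
  refine absurd hx (not_lt.2 (this.trans_eq ?_))
  congr 1
  ring

/-- All sets of `L` keys lock the message simultaneously. -/
theorem IsPhaseEnsemble.measure_exists_lt_eveInformation_le (h : IsPhaseEnsemble P θ)
    (hd : 0 < d) (hM : 0 < M) {δ : ℝ} (hδ : 0 < δ) {L : ℕ} (hL : 0 < L) :
    P {x | ∃ S : Finset (Fin K), S.card = L ∧
        ((2 * (frameConstant + 1) * δ * Real.logb 2 d : ℝ) : EReal)
          < eveInformation (fun m k ω => θ m k ω x) S}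
      ≤ ENNReal.ofReal (K.choose L * Real.exp (-(M * lockingRate (d / M) δ M L))) := by
  let F : Finset (Fin K) → Set Ω := fun S =>
    {x | ((2 * (frameConstant + 1) * δ * Real.logb 2 d : ℝ) : EReal)
      < eveInformation (fun m k ω => θ m k ω x) S}
  calc _ ≤ P (⋃ S ∈ Finset.powersetCard L (Finset.univ : Finset (Fin K)), F S) := by
        refine measure_mono ?_
        rintro x ⟨S, hS, hx⟩
        simp only [Set.mem_iUnion]
        exact ⟨S, Finset.mem_powersetCard.2 ⟨Finset.subset_univ _, hS⟩, hx⟩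
    _ ≤ ∑ S ∈ Finset.powersetCard L (Finset.univ : Finset (Fin K)), P (F S) :=
        measure_biUnion_finset_le _ _
    _ ≤ ∑ S ∈ Finset.powersetCard L (Finset.univ : Finset (Fin K)),
          ENNReal.ofReal (Real.exp (-(M * lockingRate (d / M) δ M L))) := by
        refine Finset.sum_le_sum fun S hS => ?_
        have hc := (Finset.mem_powersetCard.1 hS).2
        have := h.measure_lt_eveInformation_le hd hM hδ (S := S)
          (Finset.card_pos.1 (by omega))
        rwa [hc] at this
    _ = _ := by
        rw [Finset.sum_const, Finset.card_powersetCard, Finset.card_univ, Fintype.card_fin,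
          nsmul_eq_mul, ENNReal.ofReal_mul (by positivity), ENNReal.ofReal_natCast]

end Locking

/-! ### Leaked bits, thresholds and rates. -/

/-- In bit coordinates the surviving keys form a subcube: a point at each leaked position, both
values elsewhere. -/
theorem card_survivingKeys {K κ : ℕ} (bits : Fin K ≃ (Fin κ → Bool)) (T : Finset (Fin κ))
    (b : Fin κ → Bool) : (survivingKeys bits T b).card = 2 ^ (κ - T.card) := by
  have h : survivingKeys bits T b
      = (Fintype.piFinset fun i => if i ∈ T then {b i} else Finset.univ).map
        bits.symm.toEmbedding := by
    ext k
    simp only [survivingKeys, Finset.mem_filter, Finset.mem_univ, true_and, Finset.mem_map_equiv,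
      Equiv.symm_symm, Fintype.mem_piFinset]
    refine forall_congr' fun i => ?_
    split_ifs with hi <;> simp [hi]
  rw [h, Finset.card_map, Fintype.card_piFinset]
  have : ∀ i, (if i ∈ T then ({b i} : Finset Bool) else Finset.univ).card
      = if i ∈ T then 1 else 2 := by
    intro i
    split_ifs <;> simp
  simp_rw [this]
  rw [Finset.prod_ite, Finset.prod_const_one, one_mul, Finset.prod_const]
  congr 1
  rw [Finset.filter_not, Finset.filter_mem_eq_inter, Finset.univ_inter,
    ← Finset.compl_eq_univ_sdiff, Finset.card_compl, Fintype.card_fin]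

theorem card_survivingKeys_eq_of_rpow {K κ t L : ℕ} {γ : ℝ} (bits : Fin K ≃ (Fin κ → Bool))
    (hL : (L : ℝ) = (K : ℝ) ^ (1 - γ)) (ht : (t : ℝ) = γ * κ) {T : Finset (Fin κ)}
    (hT : T.card = t) (b : Fin κ → Bool) : (survivingKeys bits T b).card = L := by
  have hK : K = 2 ^ κ := by
    have := Fintype.card_congr bits
    simpa using this
  have htκ : t ≤ κ := by
    rw [← hT]
    simpa using T.card_le_univ
  have hreal : (L : ℝ) = ((2 ^ (κ - t) : ℕ) : ℝ) := by
    rw [hL, hK]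
    push_cast
    rw [← Real.rpow_natCast, ← Real.rpow_natCast, ← Real.rpow_mul (by norm_num),
      Nat.cast_sub htκ, ht]
    congr 1
    ring
  rw [card_survivingKeys, hT]
  exact_mod_cast hreal.symm

section Rates

variable {δ : ℝ} {M L : ℕ}

/-- For `d / M = 1 / δ` the rate is affine in `L`, and `keyThreshold` is its zero. -/
theorem lockingRate_one_div_eq (hδ : 0 < δ) :
    lockingRate (1 / δ) δ M L = δ ^ 3 / 4 * (L - keyThreshold δ M) := by
  rw [lockingRate, keyThreshold]
  field_simp
  ring

theorem one_lt_keyThreshold (hδ : 0 < δ) (hδ1 : δ ≤ 1) : 1 < keyThreshold δ M := by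
  have hlog : 1 ≤ Real.log (5 / δ) := by
    rw [Real.le_log_iff_exp_le (by positivity), le_div_iff₀ hδ]
    nlinarith [Real.exp_one_lt_d9, Real.exp_pos 1]
  have h0 : 0 ≤ Real.log M := Real.log_natCast_nonneg M
  have h1 : 1 ≤ 1 / δ ^ 2 := by
    rw [one_le_div (by positivity)]
    exact pow_le_one₀ hδ.le hδ1
  have h2 : 2 ≤ 2 / δ ^ 2 * Real.log (5 / δ) := by
    have : 2 / δ ^ 2 = 2 * (1 / δ ^ 2) := by ring
    rw [this]
    nlinarith
  have h3 : 4 / δ ^ 2 = 4 * (1 / δ ^ 2) := by ring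
  rw [keyThreshold, h3]
  nlinarith

theorem natCast_choose_le_exp_mul_log (K L : ℕ) (hK : 0 < K) :
    (K.choose L : ℝ) ≤ Real.exp (L * Real.log K) := by
  rw [Real.exp_nat_mul, Real.exp_log (by exact_mod_cast hK)]
  exact_mod_cast Nat.choose_le_pow K L

/-- A relative margin `ε` in both conditions gives a uniform decay rate. -/
theorem le_lockingRate_sub_of_margin (hδ : 0 < δ) (hM : 0 < M) {ε X : ℝ} (hε : 0 < ε)
    (hL : (1 + ε) * keyThreshold δ M ≤ L)
    (hX : (1 + ε) * (X * (lockingRate (1 / δ) δ M L)⁻¹) ≤ M) (hlog : 0 < Real.log (5 / δ)) :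
    ε ^ 2 / (1 + ε) * (2 / δ * Real.log (5 / δ)) ≤ lockingRate (1 / δ) δ M L - X / M := by
  have hM' : (0 : ℝ) < M := by exact_mod_cast hM
  have hlogM : 0 ≤ Real.log M := Real.log_natCast_nonneg M
  set A := lockingRate (1 / δ) δ M L with hA
  -- The margin in `L` gives `A ≥ (δ³/4) ε B`; the `log M` part of `B` is then dropped.
  have hAlow : ε * (2 / δ * Real.log (5 / δ)) ≤ A := by
    rw [hA, lockingRate_one_div_eq hδ]
    calc ε * (2 / δ * Real.log (5 / δ))
        ≤ ε * (δ * Real.log M + 2 / δ * Real.log (5 / δ)) := by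
          gcongr
          nlinarith
      _ = δ ^ 3 / 4 * (ε * keyThreshold δ M) := by
          rw [keyThreshold]
          field_simp
      _ ≤ δ ^ 3 / 4 * (L - keyThreshold δ M) := by
          gcongr
          linarith
  have hApos : 0 < A := lt_of_lt_of_le (by positivity) hAlow
  -- The margin in `M` leaves the share `ε / (1 + ε)` of `A`, hence `ε²` in the final rate.
  have hXM : X / M ≤ A / (1 + ε) := by
    rw [div_le_div_iff₀ hM' (by positivity)]
    have h := mul_le_mul_of_nonneg_left hX hApos.le
    have : A * ((1 + ε) * (X * A⁻¹)) = X * (1 + ε) := by field_simp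
    linarith
  calc ε ^ 2 / (1 + ε) * (2 / δ * Real.log (5 / δ))
      = ε / (1 + ε) * (ε * (2 / δ * Real.log (5 / δ))) := by ring
    _ ≤ ε / (1 + ε) * A := by gcongr
    _ = A - A / (1 + ε) := by field_simp; ring
    _ ≤ A - X / M := by linarith

end Rates

/-- `(1 + γ + 2γ²)(1 - γ) = 1 + γ² (1 - 2γ) ≥ 1`. -/
theorem lt_rpow_one_sub_of_rpow_lt {B K γ : ℝ} (hB : 1 < B)
    (hγ : γ ≤ 1 / 2) (h : B ^ (1 + γ + 2 * γ ^ 2) < K) : B < K ^ (1 - γ) := by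
  have hB0 : 0 < B := by linarith
  calc B = B ^ (1 : ℝ) := (Real.rpow_one B).symm
    _ ≤ B ^ ((1 + γ + 2 * γ ^ 2) * (1 - γ)) := by
        apply Real.rpow_le_rpow_of_exponent_le hB.le
        nlinarith [mul_nonneg (sq_nonneg γ) (by linarith : 0 ≤ 1 - 2 * γ)]
    _ = (B ^ (1 + γ + 2 * γ ^ 2)) ^ (1 - γ) := Real.rpow_mul hB0.le _ _
    _ < K ^ (1 - γ) := Real.rpow_lt_rpow (by positivity) h (by linarith)

/-- `(1 - γ)(1 + γ) = 1 - γ² ≤ 1`. -/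
theorem rpow_one_add_lt_of_lt_rpow {B K γ : ℝ} (hB : 0 ≤ B) (hK : 1 ≤ K) (hγ0 : 0 ≤ γ)
    (h : B < K ^ (1 - γ)) : B ^ (1 + γ) < K := by
  calc B ^ (1 + γ) < (K ^ (1 - γ)) ^ (1 + γ) := Real.rpow_lt_rpow hB h (by linarith)
    _ = K ^ ((1 - γ) * (1 + γ)) := (Real.rpow_mul (by linarith) _ _).symm
    _ ≤ K ^ (1 : ℝ) := by
        apply Real.rpow_le_rpow_of_exponent_le hK
        nlinarith
    _ = K := Real.rpow_one K

theorem mainTheorem3 :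
    ∃ C : ℝ, 0 < C ∧
      ∀ (Ω : Type*) [MeasurableSpace Ω] (P : Measure Ω) [IsProbabilityMeasure P]
        (d M K L : ℕ) (γ δ : ℝ) (θ : Fin M → Fin K → Fin d → Ω → ℝ),
        0 < d → 0 < M → 0 < K → 0 < δ → 0 ≤ γ → γ ≤ 1 →
        (L : ℝ) = (K : ℝ) ^ (1 - γ) →
        IsPhaseEnsemble P θ →
        -- a given set of `L = K^(1-γ)` keys remains secret
        (∀ S : Finset (Fin K), S.card = L →
          P {x | ((C * δ * Real.logb 2 d : ℝ) : EReal)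
                < eveInformation (fun m k ω => θ m k ω x) S}
            ≤ ENNReal.ofReal (Real.exp (-(M * lockingRate (d / M) δ M L)))) ∧
        -- an arbitrary set of `L = K^(1-γ)` keys remains secret
        P {x | ∃ S : Finset (Fin K), S.card = L ∧
                ((C * δ * Real.logb 2 d : ℝ) : EReal)
                  < eveInformation (fun m k ω => θ m k ω x) S}
            ≤ ENNReal.ofReal
                (K.choose L * Real.exp (-(M * lockingRate (d / M) δ M L))) ∧
        -- arbitrary `γ log₂ K` bits of the key leak
        (∀ (κ t : ℕ) (bits : Fin K ≃ (Fin κ → Bool)), (t : ℝ) = γ * κ →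
          P {x | ∃ (T : Finset (Fin κ)) (b : Fin κ → Bool), T.card = t ∧
                  ((C * δ * Real.logb 2 d : ℝ) : EReal)
                    < eveInformation (fun m k ω => θ m k ω x) (survivingKeys bits T b)}
            ≤ ENNReal.ofReal
                (K.choose L * Real.exp (-(M * lockingRate (d / M) δ M L)))) ∧
        (K.choose L * Real.exp (-(M * lockingRate (d / M) δ M L))
            ≤ Real.exp ((K : ℝ) ^ (1 - γ) * Real.log K)
                * Real.exp (-(M * lockingRate (d / M) δ M L))) ∧
        -- the case `M / d = δ`
        ((M : ℝ) / d = δ → δ ≤ 1 →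
          -- the two conditions make the exponent negative
          (keyThreshold δ M < (K : ℝ) ^ (1 - γ) →
            (K : ℝ) ^ (1 - γ) * Real.log K * (lockingRate (1 / δ) δ M L)⁻¹ < M →
              0 < lockingRate (1 / δ) δ M L - (K : ℝ) ^ (1 - γ) * Real.log K / M ∧
              P {x | ∃ S : Finset (Fin K), S.card = L ∧
                      ((C * δ * Real.logb 2 d : ℝ) : EReal)
                        < eveInformation (fun m k ω => θ m k ω x) S}
                ≤ ENNReal.ofReal (Real.exp
                    (-((lockingRate (1 / δ) δ M L
                      - (K : ℝ) ^ (1 - γ) * Real.log K / M) * M)))) ∧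
          -- with a fixed relative margin `ε` in both, the decay rate in `M` is uniform
          (∀ ε : ℝ, 0 < ε →
            (1 + ε) * keyThreshold δ M ≤ (K : ℝ) ^ (1 - γ) →
            (1 + ε) * ((K : ℝ) ^ (1 - γ) * Real.log K * (lockingRate (1 / δ) δ M L)⁻¹) ≤ M →
              P {x | ∃ S : Finset (Fin K), S.card = L ∧
                      ((C * δ * Real.logb 2 d : ℝ) : EReal)
                        < eveInformation (fun m k ω => θ m k ω x) S}
                ≤ ENNReal.ofReal (Real.exp
                    (-(ε ^ 2 / (1 + ε) * (2 / δ * Real.log (5 / δ)) * M)))) ∧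
          -- for small `γ`, the first condition is `K ≳ keyThreshold ^ (1 + γ)`, where the
          -- exponent is exact up to a term `O(γ²)`
          (γ ≤ 1 / 2 →
            (keyThreshold δ M ^ (1 + γ + 2 * γ ^ 2) < (K : ℝ) →
              keyThreshold δ M < (K : ℝ) ^ (1 - γ)) ∧
            (keyThreshold δ M < (K : ℝ) ^ (1 - γ) →
              keyThreshold δ M ^ (1 + γ) < (K : ℝ)))) := by
  have ha := le_frameConstant
  refine ⟨2 * (frameConstant + 1), by linarith, ?_⟩
  intro Ω _ P _ d M K L γ δ θ hd hM hK hδ hγ0 hγ1 hL hθ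
  have hM' : (0 : ℝ) < M := by exact_mod_cast hM
  have hd' : (0 : ℝ) < d := by exact_mod_cast hd
  have hK1 : (1 : ℝ) ≤ K := by exact_mod_cast hK
  have hLpos : 0 < L := by
    have : (0 : ℝ) < L := by
      rw [hL]
      exact Real.rpow_pos_of_pos (by linarith) _
    exact_mod_cast this
  have hall := hθ.measure_exists_lt_eveInformation_le hd hM hδ hLpos
  have hchoose : (K.choose L : ℝ) ≤ Real.exp ((K : ℝ) ^ (1 - γ) * Real.log K) := by
    rw [← hL]
    exact natCast_choose_le_exp_mul_log K L hK
  refine ⟨fun S hS => ?_, hall, ?_, ?_, ?_⟩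
  · have := hθ.measure_lt_eveInformation_le hd hM hδ (S := S) (Finset.card_pos.1 (by omega))
    rwa [hS] at this
  · intro κ t bits ht
    -- Each leakage pattern leaves one of the `L`-sets of keys, so the simultaneous bound covers all
    -- positions and values.
    refine (measure_mono ?_).trans hall
    rintro x ⟨T, b, hT, hx⟩
    exact ⟨_, card_survivingKeys_eq_of_rpow bits hL ht hT b, hx⟩
  · gcongr
  · intro hMd hδ1
    have hratio : (d : ℝ) / M = 1 / δ := by
      rw [← hMd, one_div_div]
    rw [hratio] at hall
    have hexp : K.choose L * Real.exp (-(M * lockingRate (1 / δ) δ M L))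
        ≤ Real.exp (-((lockingRate (1 / δ) δ M L - (K : ℝ) ^ (1 - γ) * Real.log K / M) * M)) := by
      calc K.choose L * Real.exp (-(M * lockingRate (1 / δ) δ M L))
          ≤ Real.exp ((K : ℝ) ^ (1 - γ) * Real.log K)
            * Real.exp (-(M * lockingRate (1 / δ) δ M L)) := by gcongr
        _ = _ := by
          rw [← Real.exp_add]
          congr 1
          field_simp
          ring
    have hB := one_lt_keyThreshold (M := M) hδ hδ1
    refine ⟨fun hkey hmsg => ⟨?_, hall.trans (ENNReal.ofReal_le_ofReal hexp)⟩,
      fun ε hε hkey hmsg => hall.trans (ENNReal.ofReal_le_ofReal (hexp.trans ?_)),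
      fun hγ => ⟨fun h => lt_rpow_one_sub_of_rpow_lt hB hγ h,
        fun h => rpow_one_add_lt_of_lt_rpow (by linarith) hK1 hγ0 h⟩⟩
    · have hA : 0 < lockingRate (1 / δ) δ M L := by
        rw [lockingRate_one_div_eq hδ, hL]
        exact mul_pos (by positivity) (by linarith)
      rw [sub_pos, div_lt_iff₀ hM']
      rw [← div_eq_mul_inv, div_lt_iff₀ hA] at hmsg
      linarith
    · have hlog : 0 < Real.log (5 / δ) :=
        Real.log_pos (by rw [lt_div_iff₀ hδ]; linarith)
      rw [← hL] at hkey
      have := le_lockingRate_sub_of_margin hδ hM hε hkey hmsg hlog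
      gcongr
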